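/- Terms of strictly linear (resp. strictly affine) combinatory logic are built by application from variables, constants and the combinators $B,C,I$ (resp. $B,C,I,K$). The strictly linear (resp. affine) $\lambda$-calculus consists of the $\lambda$-terms in which every abstraction $\lambda x.M$ binds a variable that occurs free in $M$ exactly once (resp. at most once); its provable equality is the congruence generated by the $\beta$-rule and by the $\xi$-rule, both restricted to such abstractions. For a combinatory term $M$ let $(M)_\lambda$ be the $\lambda$-term obtained by replacing $B,C,I,K$ with $\lambda xyz.x(yz)$, $\lambda xyz.(xz)y$, $\lambda x.x$, $\lambda xy.x$. A strictly linear (resp. affine) combinatory algebra is a set $A$ with a binary application and distinguished elements $B,C,I$ (resp. $B,C,I,K$) such that $Bxyz=x(yz)$, $Cxyz=(xz)y$, $Ix=x$ (resp. also $Kxy=x$) for all $x,y,z\in A$. It is a strictly linear (resp. affine) $\lambda$-algebra if, for all closed combinatory terms $M,N$ with constants $c_a$ $(a\in A)$, provable equality of $(M)_\lambda$ and $(N)_\lambda$ in the strictly linear (resp. affine) $\lambda$-calculus implies $[\![M]\!]_A=[\![N]\!]_A$. It is a strictly linear (resp. affine) combinatory $\lambda$-model if there is $\epsilon\in A$ such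 that for all $x,y\in A$: $\epsilon xy=xy$, and $(\forall z\in A,\ xz=yz)\Rightarrow \epsilon x=\epsilon y$. Let $T_\Sigma$ be the set of terms over a constant $e$, unary symbols $l,r$ and a binary symbol $\langle\ ,\ \rangle$, and let $\mathcal P$ be the set of partial involutions on $T_\Sigma$, i.e. of partial injective functions $f$ with $f(u)=v\Leftrightarrow f(v)=u$. For $f,g\in\mathcal P$ put $f\cdot g=f_{rr}\cup(f_{rl};g;(f_{ll};g)^*;f_{lr})$, where $f_{ij}=\{(u,v)\mid (i(u),j(v))\in f\}$ and $;$ is composition from left to right. Let $B,C,I\in\mathcal P$ be given, with $x$ ranging over $T_\Sigma$, by $$B:\ r^3x\leftrightarrow lrx,\ l^2x\leftrightarrow rlrx,\ rl^2x\leftrightarrow r^2lx;\qquad C:\ l^2x\leftrightarrow r^2lx,\ lrlx\leftrightarrow rlx,\ lr^2x\leftrightarrow r^3x;\qquad I:\ lx\leftrightarrow rx.$$ Proposition. (i) $(\mathcal P,\cdot)$ with $B,C,I$ is a strictly linear $\lambda$-algebra that is not a strictly linear combinatory $\lambda$-model; so not all strictly linear $\lambda$-algebras are strictly linear combinatory $\lambda$-models.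 (ii) Not all strictly affine $\lambda$-algebras are strictly affine combinatory $\lambda$-models. -/

import Mathlib

namespace StrictLambda

universe u

/-- The two disciplines: strictly linear and strictly affine. -/
inductive Mode : Type
  | linear
  | affine

/-- An abstracted variable occurs exactly once (linear mode), at most once (affine mode). -/
def Mode.Admits : Mode → ℕ → Prop
  | .linear, n => n = 1
  | .affine, n => n ≤ 1

/-- The distinguished combinators: `B, C, I`, and `K` in the affine mode only. -/
inductive Comb : Mode → Type
  | B {m : Mode} : Comb m
  | C {m : Mode} : Comb m
  | I {m : Mode} : Comb m
  | K : Comb Mode.affine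

/-- Terms of strictly linear (affine) combinatory logic, with variables `0, 1, 2, …` and
constants in `κ` besides the distinguished combinators. -/
inductive CLTerm (m : Mode) (κ : Type u) : Type u
  | var (n : ℕ) : CLTerm m κ
  | const (c : κ) : CLTerm m κ
  | comb (c : Comb m) : CLTerm m κ
  | app (M N : CLTerm m κ) : CLTerm m κ

/-- A term of combinatory logic is closed if no variable occurs in it. -/
def CLTerm.Closed {m : Mode} {κ : Type u} : CLTerm m κ → Prop
  | .var _ => False
  | .const _ => True
  | .comb _ => True
  | .app M N => M.Closed ∧ N.Closed

/-- Raw `λ`-terms with constants in `κ`, up to `α`-equivalence (de Bruijn indices). -/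
inductive LTerm (κ : Type u) : Type u
  | var (n : ℕ) : LTerm κ
  | const (c : κ) : LTerm κ
  | app (M N : LTerm κ) : LTerm κ
  | lam (M : LTerm κ) : LTerm κ

namespace LTerm

variable {κ : Type u}

/-- The number of free occurrences of the variable with index `k`. -/
def occ : ℕ → LTerm κ → ℕ
  | k, .var n => if n = k then 1 else 0
  | _, .const _ => 0
  | k, .app M N => occ k M + occ k N
  | k, .lam M => occ (k + 1) M

/-- Extension of a renaming under a binder. -/
def upRen (ξ : ℕ → ℕ) : ℕ → ℕ
  | 0 => 0
  | n + 1 => ξ n + 1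

def rename : (ℕ → ℕ) → LTerm κ → LTerm κ
  | ξ, .var n => .var (ξ n)
  | _, .const c => .const c
  | ξ, .app M N => .app (rename ξ M) (rename ξ N)
  | ξ, .lam M => .lam (rename (upRen ξ) M)

/-- Extension of a substitution under a binder. -/
def up (σ : ℕ → LTerm κ) : ℕ → LTerm κ
  | 0 => .var 0
  | n + 1 => rename Nat.succ (σ n)

/-- Simultaneous capture-avoiding substitution. -/
def subst : (ℕ → LTerm κ) → LTerm κ → LTerm κ
  | σ, .var n => σ n
  | _, .const c => .const c
  | σ, .app M N => .app (subst σ M) (subst σ N)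
  | σ, .lam M => .lam (subst (up σ) M)

/-- The substitution of `N` for the variable `0`, which lowers the other indices by one. -/
def single (N : LTerm κ) : ℕ → LTerm κ
  | 0 => N
  | n + 1 => .var n

/-- `M[N/x]`, where `x` is the variable bound by the abstraction of `M`. -/
def inst (M N : LTerm κ) : LTerm κ := subst (single N) M

/-- The terms of the strictly linear (affine) `λ`-calculus: every abstraction binds a variable
that occurs exactly once (at most once) in its body. -/
def WF (m : Mode) : LTerm κ → Prop
  | .var _ => True
  | .const _ => True
  | .app M N => WF m M ∧ WF m N
  | .lam M => WF m M ∧ m.Admits (occ 0 M)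

/-- Provable equality of the strictly linear (affine) `λ`-calculus: the congruence on its terms
given by the restricted `β`- and `ξ`-rules. -/
inductive Eqv (m : Mode) : LTerm κ → LTerm κ → Prop
  | refl {M : LTerm κ} : WF m M → Eqv m M M
  | symm {M N : LTerm κ} : Eqv m M N → Eqv m N M
  | trans {M N P : LTerm κ} : Eqv m M N → Eqv m N P → Eqv m M P
  | app {M M' N N' : LTerm κ} : Eqv m M M' → Eqv m N N' → Eqv m (.app M N) (.app M' N')
  | beta {M N : LTerm κ} : WF m (.lam M) → WF m N → Eqv m (.app (.lam M) N) (inst M N)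
  | xi {M N : LTerm κ} : Eqv m M N → m.Admits (occ 0 M) → m.Admits (occ 0 N) →
      Eqv m (.lam M) (.lam N)

end LTerm

/-- The `λ`-term of a combinator: `B = λxyz.x(yz)`, `C = λxyz.(xz)y`, `I = λx.x`, `K = λxy.x`. -/
def Comb.toLam {m : Mode} {κ : Type u} : Comb m → LTerm κ
  | .B => .lam (.lam (.lam (.app (.var 2) (.app (.var 1) (.var 0)))))
  | .C => .lam (.lam (.lam (.app (.app (.var 2) (.var 0)) (.var 1))))
  | .I => .lam (.var 0)
  | .K => .lam (.lam (.var 1))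

/-- The translation `M ↦ (M)_λ`, which replaces each combinator by its `λ`-term. -/
def CLTerm.toLam {m : Mode} {κ : Type u} : CLTerm m κ → LTerm κ
  | .var n => .var n
  | .const c => .const c
  | .comb c => c.toLam
  | .app M N => .app M.toLam N.toLam

/-- An applicative structure with distinguished elements for the combinators. -/
structure CombStr (m : Mode) (A : Type u) where
  app : A → A → A
  comb : Comb m → A

namespace CombStr

variable {m : Mode} {A : Type u}

/-- The equation that the element `a` has to satisfy in order to interpret a combinator. -/
def Law (S : CombStr m A) (a : A) : Comb m → Prop
  | .B => ∀ x y z, S.app (S.app (S.app a x) y) z = S.app x (S.app y z)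
  | .C => ∀ x y z, S.app (S.app (S.app a x) y) z = S.app (S.app x z) y
  | .I => ∀ x, S.app a x = x
  | .K => ∀ x y, S.app (S.app a x) y = x

/-- Strictly linear (affine) combinatory algebras. -/
def IsCombAlgebra (S : CombStr m A) : Prop :=
  ∀ c : Comb m, S.Law (S.comb c) c

/-- Interpretation of the terms with constants `c_a`, `a ∈ A`; on closed terms it does not depend
on the valuation `ρ`. -/
def eval (S : CombStr m A) (ρ : ℕ → A) : CLTerm m A → A
  | .var n => ρ n
  | .const a => a
  | .comb c => S.comb c
  | .app M N => S.app (eval S ρ M) (eval S ρ N)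

/-- Strictly linear (affine) `λ`-algebras. -/
def IsLambdaAlgebra (S : CombStr m A) : Prop :=
  S.IsCombAlgebra ∧
    ∀ M N : CLTerm m A, M.Closed → N.Closed → LTerm.Eqv m M.toLam N.toLam →
      ∀ ρ : ℕ → A, S.eval ρ M = S.eval ρ N

/-- Strictly linear (affine) combinatory `λ`-models. -/
def IsCombinatoryModel (S : CombStr m A) : Prop :=
  S.IsCombAlgebra ∧
    ∃ ε : A, (∀ x y, S.app (S.app ε x) y = S.app x y) ∧
      ∀ x y, (∀ z, S.app x z = S.app y z) → S.app ε x = S.app ε y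

end CombStr

/-- The moves: the terms over one constant `e`, unary `l`, `r` and a binary pairing. -/
inductive Move : Type
  | e : Move
  | l (t : Move) : Move
  | r (t : Move) : Move
  | pair (t u : Move) : Move

/-- Partial involutions over the moves, given by their graphs. Injectivity follows from
functionality and symmetry. -/
@[ext]
structure PInv : Type where
  rel : Move → Move → Prop
  functional : ∀ u v w, rel u v → rel u w → v = w
  symm : ∀ u v, rel u v → rel v u

namespace PInv

open Relation

/-- `sub f i j` is `f_{ij} = {(u, v) | (i(u), j(v)) ∈ f}`. -/
def sub (f : PInv) (i j : Move → Move) (u v : Move) : Prop := f.rel (i u) (j v)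

/-- The graph `f_rr ∪ (f_rl ; g ; (f_ll ; g)^* ; f_lr)` of the linear application `f · g`. -/
def appRel (f g : PInv) (u v : Move) : Prop :=
  f.sub .r .r u v ∨
    Comp (Comp (Comp (f.sub .r .l) g.rel) (ReflTransGen (Comp (f.sub .l .l) g.rel)))
      (f.sub .l .r) u v

theorem loop_symm (f g : PInv) {a b c : Move} (h : g.rel a b)
    (hs : ReflTransGen (Comp (f.sub .l .l) g.rel) b c) :
    ∃ d, g.rel c d ∧ ReflTransGen (Comp (f.sub .l .l) g.rel) d a := by
  induction hs with
  | refl => exact ⟨a, g.symm _ _ h, .refl⟩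
  | tail _ hbc ih =>
    obtain ⟨x, hx, hxc⟩ := hbc
    obtain ⟨d, hd, hda⟩ := ih
    exact ⟨x, g.symm _ _ hxc, .head ⟨_, f.symm _ _ hx, hd⟩ hda⟩

theorem appRel_symm (f g : PInv) (u v : Move) (h : f.appRel g u v) : f.appRel g v u := by
  rcases h with h | ⟨c, ⟨b, ⟨a, hua, hab⟩, hbc⟩, hcv⟩
  · exact Or.inl (f.symm _ _ h)
  · obtain ⟨d, hd, hda⟩ := loop_symm f g hab hbc
    exact Or.inr ⟨a, ⟨d, ⟨c, f.symm _ _ hcv, hd⟩, hda⟩, f.symm _ _ hua⟩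

theorem exit_unique (f g : PInv) {c c' v v' : Move}
    (h : ReflTransGen (Comp (f.sub .l .l) g.rel) c c')
    (hv : f.sub .l .r c v) (hv' : f.sub .l .r c' v') : v = v' := by
  rcases h.cases_head with rfl | ⟨_, ⟨x, hx, _⟩, _⟩
  · exact Move.r.inj (f.functional _ _ _ hv hv')
  · exact absurd (f.functional _ _ _ hv hx) (by simp)

theorem appRel_functional (f g : PInv) (u v w : Move) (h : f.appRel g u v)
    (h' : f.appRel g u w) : v = w := by
  rcases h with h | ⟨c, ⟨b, ⟨a, hua, hab⟩, hbc⟩, hcv⟩ <;>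
    rcases h' with h' | ⟨c', ⟨b', ⟨a', hua', hab'⟩, hbc'⟩, hcv'⟩
  · exact Move.r.inj (f.functional _ _ _ h h')
  · exact absurd (f.functional _ _ _ h hua') (by simp)
  · exact absurd (f.functional _ _ _ h' hua) (by simp)
  · obtain rfl := Move.l.inj (f.functional _ _ _ hua hua')
    obtain rfl := g.functional _ _ _ hab hab'
    have hu : Relator.RightUnique (Comp (f.sub .l .l) g.rel) := by
      rintro x y z ⟨p, hp, hpy⟩ ⟨q, hq, hqz⟩
      obtain rfl := Move.l.inj (f.functional _ _ _ hp hq)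
      exact g.functional _ _ _ hpy hqz
    rcases ReflTransGen.total_of_right_unique hu hbc hbc' with k | k
    · exact exit_unique f g k hcv hcv'
    · exact (exit_unique f g k hcv' hcv).symm

/-- Linear application. -/
def app (f g : PInv) : PInv where
  rel := f.appRel g
  functional := f.appRel_functional g
  symm := f.appRel_symm g

/-- `r³x ↔ lrx`, `l²x ↔ rlrx`, `rl²x ↔ r²lx`, read from left to right. -/
inductive BRule : Move → Move → Prop
  | one (x : Move) : BRule (.r (.r (.r x))) (.l (.r x))
  | two (x : Move) : BRule (.l (.l x)) (.r (.l (.r x)))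
  | three (x : Move) : BRule (.r (.l (.l x))) (.r (.r (.l x)))

/-- `l²x ↔ r²lx`, `lrlx ↔ rlx`, `lr²x ↔ r³x`, read from left to right. -/
inductive CRule : Move → Move → Prop
  | one (x : Move) : CRule (.l (.l x)) (.r (.r (.l x)))
  | two (x : Move) : CRule (.l (.r (.l x))) (.r (.l x))
  | three (x : Move) : CRule (.l (.r (.r x))) (.r (.r (.r x)))

/-- `lx ↔ rx`, read from left to right. -/
inductive IRule : Move → Move → Prop
  | one (x : Move) : IRule (.l x) (.r x)

def B : PInv where
  rel u v := BRule u v ∨ BRule v u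
  functional := by
    rintro u v w (h | h) (h' | h') <;> cases h <;> cases h' <;> rfl
  symm _ _ := Or.symm

def C : PInv where
  rel u v := CRule u v ∨ CRule v u
  functional := by
    rintro u v w (h | h) (h' | h') <;> cases h <;> cases h' <;> rfl
  symm _ _ := Or.symm

def I : PInv where
  rel u v := IRule u v ∨ IRule v u
  functional := by
    rintro u v w (h | h) (h' | h') <;> cases h <;> cases h' <;> rfl
  symm _ _ := Or.symm

/-- The strictly linear combinatory algebra of partial involutions. -/
def alg : CombStr Mode.linear PInv where
  app := app
  comb
    | .B => B
    | .C => C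
    | .I => I

end PInv

end StrictLambda

namespace StrictLambda

universe u v

/-! Both halves rest on one observation: being a `λ`-algebra passes to substructures, while the
extensionality clause for `ε` does not, because the arguments that separate two elements may be
missing from the substructure.

The notion that carries this is `IsStableModel`: a combinatory `λ`-model in which `ε` also fixes the
combinators and their partial applications. There `λx.M` is interpreted by `ε` applied to the
bracket abstraction of `M`. Weak extensionality validates `ξ`, the combinator laws validate `β`
(`interp_eq_of_eqv`), and stability makes the `λ`-terms of the combinators denote the combinators
(`interp_comb`). Hence everything that embeds into a stable model is a `λ`-algebra
(`isLambdaAlgebra_of_embedding`).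

In the linear case the partial involutions embed into relations on moves enlarged by countably many
channels. Each relation uses finitely many channels, and an argument wired to a fresh channel
exposes everything that application can observe (`app_wire`). Without channels extensionality fails:
an involution whose only edge is a loop at `l (l e)` or at `l e` never receives a token from outside
and acts like the empty one, yet any `ε` satisfying the application law acts on enough nodes as
`λxy.xy` to transmit the loop (`alg_not_isCombinatoryModel`).

In the affine case the stable model consists of sets of tokens graded by monomials, where a fresh
indeterminate marks the argument (`app_fresh`). With one indeterminate no fresh one remains: a
constant arrow present in all grades hides an ordinary arrow that `ε` would have to detect
(`univariate_not_isCombinatoryModel`). -/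

/-- The valuation `z, ρ 0, ρ 1, …`. -/
def scons {A : Type u} (z : A) (ρ : ℕ → A) : ℕ → A
  | 0 => z
  | n + 1 => ρ n

/-! ### Occurrence counts and well-formedness under renaming and substitution. -/

namespace LTerm

variable {κ : Type u} {m : Mode}

/-- The hypothesis, that `k` is the only preimage of `j`, is inherited by `upRen ξ` at `j + 1` and
`k + 1`, so the induction passes under binders. -/
theorem occ_rename_of_iff {M : LTerm κ} {ξ : ℕ → ℕ} {j k : ℕ} (h : ∀ n, ξ n = j ↔ n = k) :
    occ j (rename ξ M) = occ k M := by
  induction M generalizing ξ j k with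
  | var n => simp [rename, occ, h]
  | const c => rfl
  | app M N ihM ihN => simp [rename, occ, ihM h, ihN h]
  | lam M ih =>
    refine ih (ξ := upRen ξ) fun n => ?_
    cases n <;> simp [upRen, h]

theorem occ_rename_eq_zero {M : LTerm κ} {ξ : ℕ → ℕ} {j : ℕ} (h : ∀ n, ξ n ≠ j) :
    occ j (rename ξ M) = 0 := by
  induction M generalizing ξ j with
  | var n => simp [rename, occ, h]
  | const c => rfl
  | app M N ihM ihN => simp [rename, occ, ihM h, ihN h]
  | lam M ih =>
    refine ih (ξ := upRen ξ) fun n => ?_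
    cases n <;> simp [upRen, h]

theorem occ_zero_upRen (M : LTerm κ) (ξ : ℕ → ℕ) : occ 0 (rename (upRen ξ) M) = occ 0 M :=
  occ_rename_of_iff fun n => by cases n <;> simp [upRen]

theorem WF.rename {M : LTerm κ} (h : WF m M) (ξ : ℕ → ℕ) : WF m (M.rename ξ) := by
  induction M generalizing ξ with
  | var n => trivial
  | const c => trivial
  | app M N ihM ihN => exact ⟨ihM h.1 ξ, ihN h.2 ξ⟩
  | lam M ih => exact ⟨ih h.1 _, by rw [occ_zero_upRen]; exact h.2⟩

theorem occ_subst_of_eq {M : LTerm κ} {σ : ℕ → LTerm κ} {j k : ℕ}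
    (h : ∀ n, occ j (σ n) = if n = k then 1 else 0) : occ j (subst σ M) = occ k M := by
  induction M generalizing σ j k with
  | var n => simp [subst, occ, h]
  | const c => rfl
  | app M N ihM ihN => simp [subst, occ, ihM h, ihN h]
  | lam M ih =>
    refine ih (σ := up σ) fun n => ?_
    cases n with
    | zero => simp [up, occ]
    | succ n =>
      rw [up, occ_rename_of_iff (k := j) (by simp), h]
      simp

theorem occ_zero_up (M : LTerm κ) (σ : ℕ → LTerm κ) : occ 0 (subst (up σ) M) = occ 0 M :=
  occ_subst_of_eq fun n => by
    cases n with
    | zero => simp [up, occ]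
    | succ n => simp [up, occ_rename_eq_zero]

theorem WF.up {σ : ℕ → LTerm κ} (h : ∀ n, WF m (σ n)) (n : ℕ) : WF m (up σ n) := by
  cases n with
  | zero => trivial
  | succ n => exact (h n).rename _

theorem WF.subst {M : LTerm κ} (h : WF m M) {σ : ℕ → LTerm κ} (hσ : ∀ n, WF m (σ n)) :
    WF m (M.subst σ) := by
  induction M generalizing σ with
  | var n => exact hσ n
  | const c => trivial
  | app M N ihM ihN => exact ⟨ihM h.1 hσ, ihN h.2 hσ⟩
  | lam M ih => exact ⟨ih h.1 (WF.up hσ), by rw [occ_zero_up]; exact h.2⟩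

theorem WF.single {N : LTerm κ} (h : WF m N) (n : ℕ) : WF m (single N n) := by
  cases n with
  | zero => exact h
  | succ n => trivial

/-- Soundness of `xi` needs well-formed bodies, whereas the rule itself records only their
occurrence counts. -/
theorem Eqv.wf {M N : LTerm κ} (h : Eqv m M N) : WF m M ∧ WF m N := by
  induction h with
  | refl h => exact ⟨h, h⟩
  | symm _ ih => exact ih.symm
  | trans _ _ ih₁ ih₂ => exact ⟨ih₁.1, ih₂.2⟩
  | app _ _ ih₁ ih₂ => exact ⟨⟨ih₁.1, ih₂.1⟩, ih₁.2, ih₂.2⟩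
  | beta hM hN => exact ⟨⟨hM, hN⟩, hM.1.subst hN.single⟩
  | xi _ h₁ h₂ ih => exact ⟨⟨ih.1, h₁⟩, ih.2, h₂⟩

end LTerm

/-! ### Bracket abstraction for strictly linear and strictly affine terms. -/

namespace CLTerm

variable {m : Mode} {κ : Type u}

/-- The number of occurrences of a variable. -/
def occ (k : ℕ) : CLTerm m κ → ℕ
  | .var n => if n = k then 1 else 0
  | .const _ => 0
  | .comb _ => 0
  | .app M N => occ k M + occ k N

/-- Lowers all indices by one; meant for terms in which the variable `0` does not occur. -/
def lower : CLTerm m κ → CLTerm m κ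
  | .var n => .var (n - 1)
  | .const c => .const c
  | .comb c => .comb c
  | .app M N => .app (lower M) (lower N)

/-- Vacuous abstraction, available in the affine mode only. -/
def vacuous : {m : Mode} → CLTerm m κ → CLTerm m κ
  -- A dummy value: in linear mode the abstracted variable occurs, and `abs` recurses only into the
  -- factor containing it.
  | .linear, M => M
  | .affine, M => .app (.comb .K) M

/-- Bracket abstraction of the variable `0`. -/
def abs : CLTerm m κ → CLTerm m κ
  | .var 0 => .comb .I
  | .var (n + 1) => vacuous (.var n)
  | .const c => vacuous (.const c)
  | .comb c => vacuous (.comb c)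
  | .app M N =>
    if occ 0 N = 0 then
      if occ 0 M = 0 then vacuous (.app M.lower N.lower)
      else .app (.app (.comb .C) (abs M)) N.lower
    else .app (.app (.comb .B) M.lower) (abs N)

theorem occ_lower {M : CLTerm m κ} (h : occ 0 M = 0) (k : ℕ) : occ k M.lower = occ (k + 1) M := by
  induction M with
  | var n =>
    cases n with
    | zero => simp [occ] at h
    | succ n => simp [occ, lower]
  | const c => rfl
  | comb c => rfl
  | app M N ihM ihN =>
    simp only [occ, Nat.add_eq_zero_iff] at h
    simp [occ, lower, ihM h.1, ihN h.2]

theorem occ_vacuous (M : CLTerm m κ) (k : ℕ) : occ k M.vacuous = occ k M := by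
  cases m <;> simp [vacuous, occ]

/-- The bound matters for applications: `abs` searches only one factor and lowers the other, which
must not contain the variable. -/
theorem occ_abs {M : CLTerm m κ} (h : occ 0 M ≤ 1) (k : ℕ) : occ k M.abs = occ (k + 1) M := by
  induction M with
  | var n => cases n <;> simp [occ, abs, occ_vacuous]
  | const c => simp [occ, abs, occ_vacuous]
  | comb c => simp [occ, abs, occ_vacuous]
  | app M N ihM ihN =>
    simp only [occ] at h
    by_cases hN : occ 0 N = 0
    · by_cases hM : occ 0 M = 0
      · simp [abs, hN, hM, occ_vacuous, occ, occ_lower]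
      · simp [abs, hN, hM, occ, occ_lower, ihM (by omega)]
    · have hM : occ 0 M = 0 := by omega
      simp [abs, hN, occ, occ_lower hM, ihN (by omega)]

end CLTerm

theorem Mode.Admits.le_one {m : Mode} {n : ℕ} (h : m.Admits n) : n ≤ 1 := by
  cases m
  · exact (show n = 1 from h).le
  · exact h

/-! ### Stable models and the `β`-law of bracket abstraction. -/

namespace CombStr

variable {m : Mode} {A : Type u}

/-- The element `a` and its partial applications up to the arity of the combinator are fixed
by `ε`. -/
def FixedBy (S : CombStr m A) (ε a : A) : Comb m → Prop
  | .B => S.app ε a = a ∧ (∀ x, S.app ε (S.app a x) = S.app a x) ∧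
      ∀ x y, S.app ε (S.app (S.app a x) y) = S.app (S.app a x) y
  | .C => S.app ε a = a ∧ (∀ x, S.app ε (S.app a x) = S.app a x) ∧
      ∀ x y, S.app ε (S.app (S.app a x) y) = S.app (S.app a x) y
  | .I => S.app ε a = a
  | .K => S.app ε a = a ∧ ∀ x, S.app ε (S.app a x) = S.app a x

/-- Combinatory `λ`-models, witnessed by `ε`, whose combinators are invariant under `ε`. -/
structure IsStableModel (S : CombStr m A) (ε : A) : Prop where
  isCombAlgebra : S.IsCombAlgebra
  app_app : ∀ x y, S.app (S.app ε x) y = S.app x y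
  weakExt : ∀ x y, (∀ z, S.app x z = S.app y z) → S.app ε x = S.app ε y
  fixed : ∀ c, S.FixedBy ε (S.comb c) c

variable {S : CombStr m A}

theorem eval_lower {M : CLTerm m A} (h : M.occ 0 = 0) (ρ : ℕ → A) (z : A) :
    S.eval ρ M.lower = S.eval (scons z ρ) M := by
  induction M with
  | var n =>
    cases n with
    | zero => simp [CLTerm.occ] at h
    | succ n => rfl
  | const c => rfl
  | comb c => rfl
  | app M N ihM ihN =>
    simp only [CLTerm.occ, Nat.add_eq_zero_iff] at h
    simp [eval, CLTerm.lower, ihM h.1, ihN h.2]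

theorem eval_vacuous (hS : S.IsCombAlgebra) {M : CLTerm m A} (h : m.Admits 0) (ρ : ℕ → A) (z : A) :
    S.app (S.eval ρ M.vacuous) z = S.eval ρ M := by
  cases m
  · exact absurd h (by simp [Mode.Admits])
  · exact hS .K _ _

/-- Each clause of `abs` is undone by the law of the combinator it introduces. The law of `K` is
called upon only when the mode admits zero occurrences. -/
theorem eval_abs (hS : S.IsCombAlgebra) {M : CLTerm m A} (h : m.Admits (M.occ 0)) (ρ : ℕ → A)
    (z : A) : S.app (S.eval ρ M.abs) z = S.eval (scons z ρ) M := by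
  induction M with
  | var n =>
    cases n with
    | zero => exact hS .I _
    | succ n => exact eval_vacuous hS h ρ z
  | const c => exact eval_vacuous hS h ρ z
  | comb c => exact eval_vacuous hS h ρ z
  | app M N ihM ihN =>
    by_cases hN : N.occ 0 = 0
    · by_cases hM : M.occ 0 = 0
      · simp only [CLTerm.occ, hM, hN] at h
        simp only [CLTerm.abs, hN, hM, if_true]
        rw [eval_vacuous hS h]
        simp [eval, eval_lower hM ρ z, eval_lower hN ρ z]
      · simp only [CLTerm.occ, hN, add_zero] at h
        simp only [CLTerm.abs, hN, hM, if_true, if_false, eval]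
        rw [hS .C, ihM h, eval_lower hN ρ z]
    · have h1 := h.le_one
      simp only [CLTerm.occ] at h1
      have hM : M.occ 0 = 0 := by omega
      simp only [CLTerm.occ, hM, zero_add] at h
      simp only [CLTerm.abs, hN, if_false, eval]
      rw [hS .B, ihN h, eval_lower hM ρ z]

end CombStr

/-- Translation of `λ`-terms into combinatory terms by bracket abstraction, followed by an
application of `ε`. -/
def LTerm.toCL {κ : Type v} {A : Type u} (m : Mode) (i : κ → A) (ε : A) : LTerm κ → CLTerm m A
  | .var n => .var n
  | .const c => .const (i c)
  | .app M N => .app (toCL m i ε M) (toCL m i ε N)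
  | .lam M => .app (.const ε) (toCL m i ε M).abs

theorem LTerm.occ_toCL {κ : Type v} {A : Type u} {m : Mode} {i : κ → A} {ε : A} {M : LTerm κ}
    (h : M.WF m) (k : ℕ) : (M.toCL m i ε).occ k = M.occ k := by
  induction M generalizing k with
  | var n => rfl
  | const c => rfl
  | app M N ihM ihN => simp [toCL, occ, CLTerm.occ, ihM h.1, ihN h.2]
  | lam M ih =>
    simp only [toCL, occ, CLTerm.occ, zero_add]
    rw [CLTerm.occ_abs, ih h.1]
    rw [ih h.1]
    exact h.2.le_one

/-! ### Interpretation of `λ`-terms in a stable model and its soundness. -/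

namespace CombStr

variable {m : Mode} {A : Type u} {κ : Type v}

/-- Interpretation of `λ`-terms. -/
def interp (S : CombStr m A) (ε : A) (i : κ → A) (ρ : ℕ → A) (M : LTerm κ) : A :=
  S.eval ρ (M.toCL m i ε)

variable {S : CombStr m A} {ε : A}

namespace IsStableModel

variable {i : κ → A}

theorem abs_app (hS : S.IsStableModel ε) {M : LTerm κ} (hM : (LTerm.lam M).WF m) (ρ : ℕ → A)
    (z : A) : S.app (S.eval ρ (M.toCL m i ε).abs) z = S.interp ε i (scons z ρ) M :=
  eval_abs hS.isCombAlgebra (by rw [LTerm.occ_toCL hM.1]; exact hM.2) ρ z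

theorem lam_app (hS : S.IsStableModel ε) {M : LTerm κ} (hM : (LTerm.lam M).WF m) (ρ : ℕ → A)
    (z : A) : S.app (S.interp ε i ρ (.lam M)) z = S.interp ε i (scons z ρ) M :=
  (hS.app_app _ z).trans (hS.abs_app hM ρ z)

/-- The semantic `ξ`-rule: `ε` identifies abstractions that agree on all arguments. Two valuations
are allowed so that renaming and substitution under a binder become instances. -/
theorem lam_congr (hS : S.IsStableModel ε) {M N : LTerm κ} (hM : (LTerm.lam M).WF m)
    (hN : (LTerm.lam N).WF m) {ρ ρ' : ℕ → A}
    (h : ∀ z, S.interp ε i (scons z ρ) M = S.interp ε i (scons z ρ') N) :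
    S.interp ε i ρ (.lam M) = S.interp ε i ρ' (.lam N) :=
  hS.weakExt _ _ fun z => by
    have h₁ := hS.abs_app (i := i) hM ρ z
    have h₂ := hS.abs_app (i := i) hN ρ' z
    exact (h₁.trans (h z)).trans h₂.symm

/-- An element fixed by `ε` is determined by its action; this recognises the combinators as values
of their `λ`-terms. -/
theorem lam_eq (hS : S.IsStableModel ε) {M : LTerm κ} (hM : (LTerm.lam M).WF m) {ρ : ℕ → A}
    {a : A} (ha : S.app ε a = a) (h : ∀ z, S.app a z = S.interp ε i (scons z ρ) M) :
    S.interp ε i ρ (.lam M) = a := by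
  rw [← ha]
  exact hS.weakExt _ _ fun z => (hS.abs_app (i := i) hM ρ z).trans (h z).symm

theorem interp_rename (hS : S.IsStableModel ε) {M : LTerm κ} (hM : M.WF m) (ξ : ℕ → ℕ)
    (ρ : ℕ → A) : S.interp ε i ρ (M.rename ξ) = S.interp ε i (fun n => ρ (ξ n)) M := by
  induction M generalizing ξ ρ with
  | var n => rfl
  | const c => rfl
  | app M N ihM ihN => exact congrArg₂ S.app (ihM hM.1 ξ ρ) (ihN hM.2 ξ ρ)
  | lam M ih =>
    refine hS.lam_congr (hM.rename ξ) hM fun z => ?_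
    rw [ih hM.1]
    congr 1
    funext n
    cases n <;> rfl

theorem interp_subst (hS : S.IsStableModel ε) {M : LTerm κ} (hM : M.WF m) {σ : ℕ → LTerm κ}
    (hσ : ∀ n, (σ n).WF m) (ρ : ℕ → A) :
    S.interp ε i ρ (M.subst σ) = S.interp ε i (fun n => S.interp ε i ρ (σ n)) M := by
  induction M generalizing σ ρ with
  | var n => rfl
  | const c => rfl
  | app M N ihM ihN => exact congrArg₂ S.app (ihM hM.1 hσ ρ) (ihN hM.2 hσ ρ)
  | lam M ih =>
    refine hS.lam_congr (hM.subst hσ) hM fun z => ?_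
    rw [ih hM.1 (LTerm.WF.up hσ)]
    congr 1
    funext n
    cases n with
    | zero => rfl
    | succ n => exact hS.interp_rename (hσ n) _ _

theorem interp_inst (hS : S.IsStableModel ε) {M N : LTerm κ} (hM : M.WF m) (hN : N.WF m)
    (ρ : ℕ → A) :
    S.interp ε i ρ (M.inst N) = S.interp ε i (scons (S.interp ε i ρ N) ρ) M := by
  rw [LTerm.inst, hS.interp_subst hM hN.single]
  congr 1
  funext n
  cases n <;> rfl

/-- Provable equality is sound for the interpretation in a stable model. -/
theorem interp_eq_of_eqv (hS : S.IsStableModel ε) {M N : LTerm κ} (h : LTerm.Eqv m M N)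
    (ρ : ℕ → A) : S.interp ε i ρ M = S.interp ε i ρ N := by
  induction h generalizing ρ with
  | refl _ => rfl
  | symm _ ih => exact (ih ρ).symm
  | trans _ _ ih₁ ih₂ => exact (ih₁ ρ).trans (ih₂ ρ)
  | app _ _ ih₁ ih₂ => exact congrArg₂ S.app (ih₁ ρ) (ih₂ ρ)
  | beta hM hN => exact (hS.lam_app hM ρ _).trans (hS.interp_inst hM.1 hN ρ).symm
  | xi h h₁ h₂ ih => exact hS.lam_congr ⟨h.wf.1, h₁⟩ ⟨h.wf.2, h₂⟩ fun z => ih _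

/-- The abstractions are peeled off one at a time. At every layer `lam_eq` needs the partial
application reached so far to be fixed by `ε`, which is what `FixedBy` supplies. -/
theorem interp_comb (hS : S.IsStableModel ε) (c : Comb m) (ρ : ℕ → A) :
    S.interp ε i ρ c.toLam = S.comb c := by
  have hf := hS.fixed c
  have hl := hS.isCombAlgebra c
  cases c with
  | B =>
    refine hS.lam_eq (by cases m <;> simp [LTerm.WF, LTerm.occ, Mode.Admits]) hf.1 fun x => ?_
    refine (hS.lam_eq (by cases m <;> simp [LTerm.WF, LTerm.occ, Mode.Admits])
      (hf.2.1 x) fun y => ?_).symm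
    refine (hS.lam_eq (by cases m <;> simp [LTerm.WF, LTerm.occ, Mode.Admits])
      (hf.2.2 x y) fun z => ?_).symm
    exact hl x y z
  | C =>
    refine hS.lam_eq (by cases m <;> simp [LTerm.WF, LTerm.occ, Mode.Admits]) hf.1 fun x => ?_
    refine (hS.lam_eq (by cases m <;> simp [LTerm.WF, LTerm.occ, Mode.Admits])
      (hf.2.1 x) fun y => ?_).symm
    refine (hS.lam_eq (by cases m <;> simp [LTerm.WF, LTerm.occ, Mode.Admits])
      (hf.2.2 x y) fun z => ?_).symm
    exact hl x y z
  | I =>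
    exact hS.lam_eq (by cases m <;> simp [LTerm.WF, LTerm.occ, Mode.Admits]) hf fun x => hl x
  | K =>
    refine hS.lam_eq (by simp [LTerm.WF, LTerm.occ, Mode.Admits]) hf.1 fun x => ?_
    refine (hS.lam_eq (by simp [LTerm.WF, LTerm.occ, Mode.Admits]) (hf.2 x) fun y => ?_).symm
    exact hl x y

/-- A structure that embeds into a stable model is a `λ`-algebra. -/
theorem isLambdaAlgebra_of_embedding (hS : S.IsStableModel ε) {T : CombStr m κ}
    (hi : Function.Injective i) (happ : ∀ x y, i (T.app x y) = S.app (i x) (i y))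
    (hcomb : ∀ c, i (T.comb c) = S.comb c) : T.IsLambdaAlgebra := by
  constructor
  · intro c
    have h := hS.isCombAlgebra c
    rw [← hcomb] at h
    cases c with
    | B => exact fun x y z => hi (by simpa only [happ] using h (i x) (i y) (i z))
    | C => exact fun x y z => hi (by simpa only [happ] using h (i x) (i y) (i z))
    | I => exact fun x => hi (by simpa only [happ] using h (i x))
    | K => exact fun x y => hi (by simpa only [happ] using h (i x) (i y))
  · intro M N _ _ h ρ
    -- Although `ε` need not lie in the image of `i`, the value of `M.toLam` does, because
    -- `interp_comb` removes every `ε` introduced by the combinators.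
    have key (M : CLTerm m κ) :
        S.interp ε i (fun n => i (ρ n)) M.toLam = i (T.eval ρ M) := by
      induction M with
      | var n => rfl
      | const c => rfl
      | comb c => exact (hS.interp_comb c _).trans (hcomb c).symm
      | app M N ihM ihN => exact (congrArg₂ S.app ihM ihN).trans (happ _ _).symm
    exact hi (by rw [← key, ← key, hS.interp_eq_of_eqv h])

end IsStableModel

end CombStr

/-! ### Relations with channels and their linear application. -/

/-- Moves, extended by countably many channels that carry moves to the environment. -/
abbrev Node : Type := Move ⊕ (ℕ × Move)

/-- Relations between nodes. -/
abbrev NRel : Type := Node → Node → Prop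

namespace NRel

open Move

/-- `Run f g true x q` (`Run f g false x q`): a token that enters `f` (enters `g`) at the node `x`
can leave the system in which `g` is the argument of `f` at the node `q`. -/
inductive Run (f g : NRel) : Bool → Node → Node → Prop
  | out {x u} : f x (.inl (r u)) → Run f g true x (.inl u)
  | chan {x c} : f x (.inr c) → Run f g true x (.inr c)
  | arg {x v q} : f x (.inl (l v)) → Run f g false (.inl v) q → Run f g true x q
  | argChan {x c} : g x (.inr c) → Run f g false x (.inr c)
  | back {x v q} : g x (.inl v) → Run f g true (.inl (l v)) q → Run f g false x q

/-- The places where a token coming from the environment can enter. -/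
inductive Start : Node → Bool → Node → Prop
  | out (u) : Start (.inl u) true (.inl (r u))
  | chan (c) : Start (.inr c) true (.inr c)
  | argChan (c) : Start (.inr c) false (.inr c)

/-- Linear application of relations. -/
def app (f g : NRel) : NRel := fun p q => ∃ b x, Start p b x ∧ Run f g b x q

/-- How a token goes on when it leaves a function at a node, with `K` as the continuation in the
argument. -/
inductive Resume (K : Move → Node → Prop) : Node → Node → Prop
  | out (u) : Resume K (.inl (r u)) (.inl u)
  | chan (c) : Resume K (.inr c) (.inr c)
  | arg {v q} : K v q → Resume K (.inl (l v)) q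

/-- How a token goes on when it leaves an argument at a node, with `K` as the continuation in the
function. -/
inductive Return (K : Move → Node → Prop) : Node → Node → Prop
  | chan (c) : Return K (.inr c) (.inr c)
  | back {v q} : K v q → Return K (.inl v) q

theorem Run.of_resume {f g : NRel} {x w q : Node} (h : f x w)
    (hw : Resume (fun v => Run f g false (.inl v)) w q) : Run f g true x q := by
  cases hw with
  | out u => exact .out h
  | chan c => exact .chan h
  | arg hK => exact .arg h hK

theorem Run.of_return {f g : NRel} {x w q : Node} (h : g x w)
    (hw : Return (fun v => Run f g true (.inl (l v))) w q) : Run f g false x q := by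
  cases hw with
  | chan c => exact .argChan h
  | back hK => exact .back h hK

/-- The relation given by a partial function on moves. -/
def ofFun (h : Move → Option Move) : NRel
  | .inl u, .inl v => h u = some v
  | _, _ => False

theorem run_ofFun_true {h : Move → Option Move} {g : NRel} {u : Move} {q : Node} :
    Run (ofFun h) g true (.inl u) q ↔
      (∃ v, h u = some (r v) ∧ q = .inl v) ∨
        ∃ v, h u = some (l v) ∧ Run (ofFun h) g false (.inl v) q := by
  constructor
  · rintro (h | h | h)
    · exact Or.inl ⟨_, h, rfl⟩
    · exact h.elim
    · exact Or.inr ⟨_, h, ‹_›⟩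
  · rintro (⟨v, h, rfl⟩ | ⟨v, h, h'⟩)
    · exact .out h
    · exact .arg h h'

theorem run_false {f g : NRel} {x q : Node} :
    Run f g false x q ↔ ∃ w, g x w ∧ Return (fun v => Run f g true (.inl (l v))) w q := by
  constructor
  · rintro (_ | _ | _ | h | h)
    · exact ⟨_, h, .chan _⟩
    · exact ⟨_, h, .back ‹_›⟩
  · rintro ⟨w, h, hw⟩
    exact .of_return h hw

theorem app_ofFun {h : Move → Option Move} {g : NRel} {p q : Node} :
    app (ofFun h) g p q ↔
      (∃ u, p = .inl u ∧ Run (ofFun h) g true (.inl (r u)) q) ∨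
        ∃ c, p = .inr c ∧ Run (ofFun h) g false p q := by
  constructor
  · rintro ⟨b, x, hs, hr⟩
    cases hs with
    | out u => exact Or.inl ⟨u, rfl, hr⟩
    | chan c =>
      cases hr with
      | chan h => exact h.elim
      | out h => exact h.elim
      | arg h => exact h.elim
    | argChan c => exact Or.inr ⟨c, rfl, hr⟩
  · rintro (⟨u, rfl, hr⟩ | ⟨c, rfl, hr⟩)
    · exact ⟨_, _, .out u, hr⟩
    · exact ⟨_, _, .argChan c, hr⟩

/-! ### The combinators -/

def bFun : Move → Option Move
  | r (r (r x)) => some (l (r x))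
  | l (r x) => some (r (r (r x)))
  | l (l x) => some (r (l (r x)))
  | r (l (r x)) => some (l (l x))
  | r (l (l x)) => some (r (r (l x)))
  | r (r (l x)) => some (r (l (l x)))
  | _ => none

def cFun : Move → Option Move
  | l (l x) => some (r (r (l x)))
  | r (r (l x)) => some (l (l x))
  | l (r (l x)) => some (r (l x))
  | r (l x) => some (l (r (l x)))
  | l (r (r x)) => some (r (r (r x)))
  | r (r (r x)) => some (l (r (r x)))
  | _ => none

def iFun : Move → Option Move
  | l x => some (r x)
  | r x => some (l x)
  | _ => none

/-- The `η`-expansion `λxy.xy` of the identity. -/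
def eFun : Move → Option Move
  | l (r x) => some (r (r x))
  | r (r x) => some (l (r x))
  | l (l x) => some (r (l x))
  | r (l x) => some (l (l x))
  | _ => none

/-- The nodes at which a function can be entered by application. -/
inductive Visible : Node → Prop
  | l (u) : Visible (.inl (.l u))
  | r (u) : Visible (.inl (.r u))
  | chan (c) : Visible (.inr c)

theorem iFun_app (f : NRel) : app (ofFun iFun) f = f := by
  have hl (v : Move) (q : Node) : Run (ofFun iFun) f true (.inl (l v)) q ↔ q = .inl v := by
    simp [run_ofFun_true, iFun]
  have hf (x q : Node) : Run (ofFun iFun) f false x q ↔ f x q := by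
    rw [run_false]
    constructor
    · rintro ⟨w, h, hw | hw⟩
      · exact h
      · rwa [(hl _ _).1 hw]
    · intro h
      refine ⟨q, h, ?_⟩
      cases q with
      | inl v => exact .back ((hl _ _).2 rfl)
      | inr c => exact .chan c
  funext p q
  rw [app_ofFun, eq_iff_iff]
  cases p with
  | inl u => simp [run_ofFun_true, iFun, hf]
  | inr c => simp [hf]

/-- `eFun` copies exactly the nodes under `l` and `r` and lets channels through, so `ε` erases only
the edges at nodes that no application can reach. -/
theorem eFun_app {f : NRel} {p q : Node} :
    app (ofFun eFun) f p q ↔ f p q ∧ Visible p ∧ Visible q := by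
  have hl (v : Move) (q : Node) : Run (ofFun eFun) f true (.inl (l v)) q ↔
      q = .inl v ∧ Visible q := by
    rw [run_ofFun_true]
    cases v <;> simp [eFun]
    all_goals first | (rintro rfl h; cases h) | (rintro rfl; constructor)
  have hf (x q : Node) : Run (ofFun eFun) f false x q ↔ f x q ∧ Visible q := by
    rw [run_false]
    constructor
    · rintro ⟨w, h, hw | hw⟩
      · exact ⟨h, .chan _⟩
      · obtain ⟨rfl, hv⟩ := (hl _ _).1 hw
        exact ⟨h, hv⟩
    · rintro ⟨h, hv⟩
      refine ⟨q, h, ?_⟩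
      cases q with
      | inl v => exact .back ((hl _ _).2 ⟨rfl, hv⟩)
      | inr c => exact .chan c
  rw [app_ofFun]
  rcases p with u | c
  · cases u <;> simp [run_ofFun_true, eFun, hf, Visible.l, Visible.r]
    all_goals (intro _ h; cases h)
  · simp [hf, Visible.chan]

theorem eFun_app_eq_self {f : NRel} (h : ∀ p q, f p q → Visible p ∧ Visible q) :
    app (ofFun eFun) f = f := by
  funext p q
  exact propext (eFun_app.trans ⟨And.left, fun hf => ⟨hf, h p q hf⟩⟩)

/-- `BPort a a'`: the node `a` of `f` appears as the node `a'` of `B f`. -/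
inductive BPort : Node → Node → Prop
  | out (x) : BPort (.inl (r x)) (.inl (r (r x)))
  | inp (x) : BPort (.inl (l x)) (.inl (l (r x)))
  | chan (c) : BPort (.inr c) (.inr c)

/-- The relation `B f`. -/
inductive BApp (f : NRel) : NRel
  | wrap {a b a' b'} : BPort a a' → BPort b b' → f a b → BApp f a' b'
  | lr (x) : BApp f (.inl (l (l x))) (.inl (r (l x)))
  | rl (x) : BApp f (.inl (r (l x))) (.inl (l (l x)))

/-- A token leaving `f` is passed outside at once by the combinator, so a run through `f` is one
edge with relabelled ends. The edges between `l (l x)` and `r (l x)` bypass `f`: they join the input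
of the second argument to the third argument. -/
theorem bFun_app (f : NRel) : app (ofFun bFun) f = BApp f := by
  have hl (v : Move) (q : Node) : Run (ofFun bFun) f true (.inl (l v)) q ↔ BPort (.inl v) q := by
    rw [run_ofFun_true]
    constructor
    · cases v <;> simp [bFun] <;> rintro rfl
      · exact .inp _
      · exact .out _
    · rintro (_ | _) <;> simp [bFun]
  have hf (x q : Node) : Run (ofFun bFun) f false x q ↔ ∃ b, f x b ∧ BPort b q := by
    rw [run_false]
    refine exists_congr fun w => and_congr_right fun h => ⟨?_, ?_⟩
    · rintro (_ | hw)
      · exact .chan _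
      · exact (hl _ _).1 hw
    · intro hw
      cases w with
      | inl v => exact .back ((hl _ _).2 hw)
      | inr c => cases hw; exact .chan c
  funext p q
  rw [app_ofFun, eq_iff_iff]
  constructor
  · rintro (⟨u, rfl, h⟩ | ⟨c, rfl, h⟩)
    · rw [run_ofFun_true] at h
      rcases u with _ | (_ | u | u | _) | (_ | u | u | _) | _ <;> simp [bFun, hf, -Sum.exists] at h
      · subst h; exact .lr _
      · obtain ⟨b, h, hb⟩ := h
        exact .wrap (.inp _) hb h
      · subst h; exact .rl _
      · obtain ⟨b, h, hb⟩ := h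
        exact .wrap (.out _) hb h
    · obtain ⟨b, h, hb⟩ := (hf _ _).1 h
      exact .wrap (.chan _) hb h
  · rintro (⟨ha, hb, h⟩ | _ | _)
    · cases ha with
      | chan c => exact Or.inr ⟨c, rfl, (hf _ _).2 ⟨_, h, hb⟩⟩
      | out x => exact Or.inl ⟨_, rfl, run_ofFun_true.2 (by
          simpa [bFun, hf, -Sum.exists] using ⟨_, h, hb⟩)⟩
      | inp x => exact Or.inl ⟨_, rfl, run_ofFun_true.2 (by
          simpa [bFun, hf, -Sum.exists] using ⟨_, h, hb⟩)⟩
    · simp [run_ofFun_true, bFun]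
    · simp [run_ofFun_true, bFun]

/-- `CPort a a'`: the node `a` of `f` appears as the node `a'` of `C f`. -/
inductive CPort : Node → Node → Prop
  | fst (x) : CPort (.inl (l x)) (.inl (r (l x)))
  | snd (x) : CPort (.inl (r (l x))) (.inl (l x))
  | out (x) : CPort (.inl (r (r x))) (.inl (r (r x)))
  | chan (c) : CPort (.inr c) (.inr c)

/-- The relation `C f`. -/
inductive CApp (f : NRel) : NRel
  | wrap {a b a' b'} : CPort a a' → CPort b b' → f a b → CApp f a' b'

theorem cFun_app (f : NRel) : app (ofFun cFun) f = CApp f := by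
  have hl (v : Move) (q : Node) : Run (ofFun cFun) f true (.inl (l v)) q ↔ CPort (.inl v) q := by
    rw [run_ofFun_true]
    constructor
    · rcases v with _ | v | (_ | v | v | _) | _ <;> simp [cFun] <;> rintro rfl
      · exact .fst _
      · exact .snd _
      · exact .out _
    · rintro (_ | _ | _) <;> simp [cFun]
  have hf (x q : Node) : Run (ofFun cFun) f false x q ↔ ∃ b, f x b ∧ CPort b q := by
    rw [run_false]
    refine exists_congr fun w => and_congr_right fun h => ⟨?_, ?_⟩
    · rintro (_ | hw)
      · exact .chan _
      · exact (hl _ _).1 hw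
    · intro hw
      cases w with
      | inl v => exact .back ((hl _ _).2 hw)
      | inr c => cases hw; exact .chan c
  funext p q
  rw [app_ofFun, eq_iff_iff]
  constructor
  · rintro (⟨u, rfl, h⟩ | ⟨c, rfl, h⟩)
    · rw [run_ofFun_true] at h
      rcases u with _ | u | (_ | u | u | _) | _ <;> simp [cFun, hf, -Sum.exists] at h
      · obtain ⟨b, h, hb⟩ := h
        exact .wrap (.snd _) hb h
      · obtain ⟨b, h, hb⟩ := h
        exact .wrap (.fst _) hb h
      · obtain ⟨b, h, hb⟩ := h
        exact .wrap (.out _) hb h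
    · obtain ⟨b, h, hb⟩ := (hf _ _).1 h
      exact .wrap (.chan _) hb h
  · rintro ⟨ha, hb, h⟩
    cases ha with
    | chan c => exact Or.inr ⟨c, rfl, (hf _ _).2 ⟨_, h, hb⟩⟩
    | out x => exact Or.inl ⟨_, rfl, run_ofFun_true.2 (by
          simpa [cFun, hf, -Sum.exists] using ⟨_, h, hb⟩)⟩
    | fst x => exact Or.inl ⟨_, rfl, run_ofFun_true.2 (by
          simpa [cFun, hf, -Sum.exists] using ⟨_, h, hb⟩)⟩
    | snd x => exact Or.inl ⟨_, rfl, run_ofFun_true.2 (by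
          simpa [cFun, hf, -Sum.exists] using ⟨_, h, hb⟩)⟩

/-! ### The laws of `B` and `C`, by comparison with flat systems of three parts. -/

/-- The three parts of a system of relations. -/
inductive Part : Type
  | fst | snd | trd

/-- Runs in the system `f (g z)`. -/
inductive BRun (f g z : NRel) : Part → Node → Node → Prop
  | out {x u} : f x (.inl (r u)) → BRun f g z .fst x (.inl u)
  | chan₁ {x c} : f x (.inr c) → BRun f g z .fst x (.inr c)
  | call₁ {x v q} : f x (.inl (l v)) → BRun f g z .snd (.inl (r v)) q → BRun f g z .fst x q
  | back₂ {x v q} : g x (.inl (r v)) → BRun f g z .fst (.inl (l v)) q → BRun f g z .snd x q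
  | chan₂ {x c} : g x (.inr c) → BRun f g z .snd x (.inr c)
  | call₂ {x v q} : g x (.inl (l v)) → BRun f g z .trd (.inl v) q → BRun f g z .snd x q
  | back₃ {x v q} : z x (.inl v) → BRun f g z .snd (.inl (l v)) q → BRun f g z .trd x q
  | chan₃ {x c} : z x (.inr c) → BRun f g z .trd x (.inr c)

/-- Runs in the system `f z g`. -/
inductive CRun (f g z : NRel) : Part → Node → Node → Prop
  | out {x u} : f x (.inl (r (r u))) → CRun f g z .fst x (.inl u)
  | chan₁ {x c} : f x (.inr c) → CRun f g z .fst x (.inr c)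
  | call₂ {x v q} : f x (.inl (r (l v))) → CRun f g z .snd (.inl v) q → CRun f g z .fst x q
  | call₃ {x v q} : f x (.inl (l v)) → CRun f g z .trd (.inl v) q → CRun f g z .fst x q
  | back₂ {x v q} : g x (.inl v) → CRun f g z .fst (.inl (r (l v))) q → CRun f g z .snd x q
  | chan₂ {x c} : g x (.inr c) → CRun f g z .snd x (.inr c)
  | back₃ {x v q} : z x (.inl v) → CRun f g z .fst (.inl (l v)) q → CRun f g z .trd x q
  | chan₃ {x c} : z x (.inr c) → CRun f g z .trd x (.inr c)

/-- The places where a token can enter a system with three parts, the first of which returns the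
result through the nodes `out u`. -/
inductive Start₃ (out : Move → Move) : Node → Part → Node → Prop
  | out (u) : Start₃ out (.inl u) .fst (.inl (out u))
  | chan (s c) : Start₃ out (.inr c) s (.inr c)

section B

variable {f g z : NRel}

theorem BRun.of_run_inner {b : Bool} {x w : Node} (h : Run g z b x w) {q : Node}
    (hw : Return (fun v => BRun f g z .fst (.inl (l v))) w q) :
    BRun f g z (bif b then .snd else .trd) x q := by
  induction h with
  | out h => cases hw with | back hK => exact .back₂ h hK
  | chan h => cases hw; exact .chan₂ h
  | arg h _ ih => exact .call₂ h (ih hw)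
  | argChan h => cases hw; exact .chan₃ h
  | back h _ ih => exact .back₃ h (ih hw)

/-- Both bracketings in the law of `B` are compared with the same flat system. Here an induction on
the outer run unfolds each edge of `app g z` into an inner run, which `of_run_inner` splices with
the rest. -/
theorem BRun.of_app_app {p q : Node} (h : app f (app g z) p q) :
    ∃ s x, Start₃ r p s x ∧ BRun f g z s x q := by
  have key {b : Bool} {x q : Node} (h : Run f (app g z) b x q) :
      (b = true → BRun f g z .fst x q) ∧
        (b = false → ∃ b' x', Start x b' x' ∧ BRun f g z (bif b' then .snd else .trd) x' q) := by
    induction h with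
    | out h => simpa using .out h
    | chan h => simpa using .chan₁ h
    | arg h _ ih =>
      obtain ⟨b', x', hs, hr⟩ := ih.2 rfl
      cases hs
      simpa using .call₁ h hr
    | argChan h =>
      obtain ⟨b', x', hs, hr⟩ := h
      exact ⟨nofun, fun _ => ⟨b', x', hs, .of_run_inner hr (.chan _)⟩⟩
    | back h _ ih =>
      obtain ⟨b', x', hs, hr⟩ := h
      exact ⟨nofun, fun _ => ⟨b', x', hs, .of_run_inner hr (.back (ih.1 rfl))⟩⟩
  obtain ⟨b, x, hs, hr⟩ := h
  cases hs with
  | out u => exact ⟨_, _, .out u, (key hr).1 rfl⟩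
  | chan c => exact ⟨_, _, .chan _ c, (key hr).1 rfl⟩
  | argChan c =>
    obtain ⟨b', x', hs, hr⟩ := (key hr).2 rfl
    cases hs with
    | chan => exact ⟨_, _, .chan _ c, hr⟩
    | argChan => exact ⟨_, _, .chan _ c, hr⟩

/-- A token at the second or third part is inside `app g z`; the induction therefore has to produce
the inner run up to its exit `w` together with the outer run that continues from `w`. -/
theorem BRun.app_app {p q x : Node} {s : Part} (hs : Start₃ r p s x) (h : BRun f g z s x q) :
    app f (app g z) p q := by
  have key {s : Part} {x q : Node} (h : BRun f g z s x q) :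
      match s with
      | .fst => Run f (app g z) true x q
      | .snd => ∃ w, Run g z true x w ∧
          Return (fun v => Run f (app g z) true (.inl (l v))) w q
      | .trd => ∃ w, Run g z false x w ∧
          Return (fun v => Run f (app g z) true (.inl (l v))) w q := by
    induction h with
    | out h => exact .out h
    | chan₁ h => exact .chan h
    | call₁ h _ ih =>
      obtain ⟨w, hr, hw⟩ := ih
      exact .arg h (.of_return ⟨_, _, .out _, hr⟩ hw)
    | back₂ h _ ih => exact ⟨_, .out h, .back ih⟩
    | chan₂ h => exact ⟨_, .chan h, .chan _⟩
    | call₂ h _ ih =>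
      obtain ⟨w, hr, hw⟩ := ih
      exact ⟨w, .arg h hr, hw⟩
    | back₃ h _ ih =>
      obtain ⟨w, hr, hw⟩ := ih
      exact ⟨w, .back h hr, hw⟩
    | chan₃ h => exact ⟨_, .argChan h, .chan _⟩
  cases hs with
  | out u => exact ⟨_, _, .out u, key h⟩
  | chan s c =>
    cases s with
    | fst => exact ⟨_, _, .chan c, key h⟩
    | snd =>
      obtain ⟨w, hr, hw⟩ := key h
      exact ⟨_, _, .argChan c, .of_return ⟨_, _, .chan c, hr⟩ hw⟩
    | trd =>
      obtain ⟨w, hr, hw⟩ := key h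
      exact ⟨_, _, .argChan c, .of_return ⟨_, _, .argChan c, hr⟩ hw⟩

/-- The three alternatives are the ways to enter `B f`: through a port of `f`, from `g` along the
bypass straight to the third argument, or from the third argument along the bypass into `g`. -/
theorem BRun.of_run_bApp {b : Bool} {x w : Node} (h : Run (BApp f) g b x w) :
    (b = true →
      (∃ a, BPort a x ∧ ∀ q, Resume (fun v => BRun f g z .trd (.inl v)) w q →
        BRun f g z .fst a q) ∨
      (∃ v, x = .inl (l (l v)) ∧ w = .inl (l v)) ∨
      (∃ v, x = .inl (r (l v)) ∧ ∀ q, Resume (fun v => BRun f g z .trd (.inl v)) w q →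
        BRun f g z .snd (.inl (l v)) q)) ∧
    (b = false → ∀ q, Resume (fun v => BRun f g z .trd (.inl v)) w q → BRun f g z .snd x q) := by
  induction h with
  | out h =>
    refine ⟨fun _ => ?_, nofun⟩
    cases h with
    | wrap ha hb h =>
      cases hb
      refine Or.inl ⟨_, ha, fun q hq => ?_⟩
      cases hq
      exact .out h
    | lr v => exact Or.inr (Or.inl ⟨v, rfl, rfl⟩)
  | chan h =>
    refine ⟨fun _ => ?_, nofun⟩
    cases h with
    | wrap ha hb h =>
      cases hb
      refine Or.inl ⟨_, ha, fun q hq => ?_⟩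
      cases hq
      exact .chan₁ h
  | arg h _ ih =>
    refine ⟨fun _ => ?_, nofun⟩
    cases h with
    | wrap ha hb h =>
      cases hb
      exact Or.inl ⟨_, ha, fun q hq => .call₁ h (ih.2 rfl q hq)⟩
    | rl v => exact Or.inr (Or.inr ⟨v, rfl, ih.2 rfl⟩)
  | argChan h =>
    refine ⟨nofun, fun _ q hq => ?_⟩
    cases hq
    exact .chan₂ h
  | back h _ ih =>
    refine ⟨nofun, fun _ q hq => ?_⟩
    rcases ih.1 rfl with ⟨a, ha, hr⟩ | ⟨v, hv, rfl⟩ | ⟨v, hv, _⟩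
    · cases ha
      exact .back₂ h (hr q hq)
    · cases hv
      cases hq with
      | arg hK => exact .call₂ h hK
    · cases hv

theorem BRun.of_app_bApp {p q : Node} (h : app (app (BApp f) g) z p q) :
    ∃ s x, Start₃ r p s x ∧ BRun f g z s x q := by
  have inner {p w q : Node} (h : app (BApp f) g p w)
      (hw : Resume (fun v => BRun f g z .trd (.inl v)) w q) :
      (∃ u, p = .inl (r u) ∧ BRun f g z .fst p q) ∨
      (∃ v, p = .inl (l v) ∧ BRun f g z .snd p q) ∨
      ∃ c, p = .inr c ∧ (BRun f g z .fst p q ∨ BRun f g z .snd p q) := by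
    obtain ⟨b, x, hs, hr⟩ := h
    have hrun := of_run_bApp (z := z) hr
    cases hs with
    | out u =>
      rcases hrun.1 rfl with ⟨a, ha, hq⟩ | ⟨v, hv, rfl⟩ | ⟨v, hv, hq⟩
      · cases ha
        exact Or.inl ⟨_, rfl, hq q hw⟩
      · cases hv
      · cases hv
        exact Or.inr (Or.inl ⟨_, rfl, hq q hw⟩)
    | chan c =>
      rcases hrun.1 rfl with ⟨a, ha, hq⟩ | ⟨v, hv, rfl⟩ | ⟨v, hv, hq⟩
      · cases ha
        exact Or.inr (Or.inr ⟨c, rfl, Or.inl (hq q hw)⟩)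
      · cases hv
      · cases hv
    | argChan c => exact Or.inr (Or.inr ⟨c, rfl, Or.inr (hrun.2 rfl q hw)⟩)
  have key {b : Bool} {x q : Node} (h : Run (app (BApp f) g) z b x q) :
      (b = true → ∃ w, app (BApp f) g x w ∧ Resume (fun v => BRun f g z .trd (.inl v)) w q) ∧
        (b = false → BRun f g z .trd x q) := by
    induction h with
    | out h => exact ⟨fun _ => ⟨_, h, .out _⟩, nofun⟩
    | chan h => exact ⟨fun _ => ⟨_, h, .chan _⟩, nofun⟩
    | arg h _ ih => exact ⟨fun _ => ⟨_, h, .arg (ih.2 rfl)⟩, nofun⟩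
    | argChan h => exact ⟨nofun, fun _ => .chan₃ h⟩
    | back h _ ih =>
      refine ⟨nofun, fun _ => ?_⟩
      obtain ⟨w, hr, hw⟩ := ih.1 rfl
      rcases inner hr hw with ⟨u, hu, hr⟩ | ⟨v, hv, hr⟩ | ⟨c, hc, hr⟩
      · cases hu
      · exact .back₃ h hr
      · cases hc
  obtain ⟨b, x, hs, hr⟩ := h
  cases hs with
  | out u =>
    obtain ⟨w, hr, hw⟩ := (key hr).1 rfl
    rcases inner hr hw with ⟨u, hu, hr⟩ | ⟨v, hv, hr⟩ | ⟨c, hc, hr⟩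
    · exact ⟨_, _, .out _, hr⟩
    · cases hv
    · cases hc
  | chan c =>
    obtain ⟨w, hr, hw⟩ := (key hr).1 rfl
    rcases inner hr hw with ⟨u, hu, hr⟩ | ⟨v, hv, hr⟩ | ⟨c, hc, hr | hr⟩
    · cases hu
    · cases hv
    · exact ⟨_, _, .chan _ _, hr⟩
    · exact ⟨_, _, .chan _ _, hr⟩
  | argChan c => exact ⟨_, _, .chan _ c, (key hr).2 rfl⟩

theorem BRun.app_bApp {p q x : Node} {s : Part} (hs : Start₃ r p s x) (h : BRun f g z s x q) :
    app (app (BApp f) g) z p q := by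
  have key {s : Part} {x q : Node} (h : BRun f g z s x q) :
      match s with
      | .fst => ∀ x', BPort x x' → ∃ w, Run (BApp f) g true x' w ∧
          Resume (fun v => Run (app (BApp f) g) z false (.inl v)) w q
      | .snd => ∃ w, Run (BApp f) g false x w ∧
          Resume (fun v => Run (app (BApp f) g) z false (.inl v)) w q
      | .trd => Run (app (BApp f) g) z false x q := by
    induction h with
    | out h => exact fun x' hx => ⟨_, .out (.wrap hx (.out _) h), .out _⟩
    | chan₁ h => exact fun x' hx => ⟨_, .chan (.wrap hx (.chan _) h), .chan _⟩
    | call₁ h _ ih =>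
      intro x' hx
      obtain ⟨w, hr, hw⟩ := ih
      exact ⟨w, .arg (.wrap hx (.inp _) h) hr, hw⟩
    | back₂ h _ ih =>
      obtain ⟨w, hr, hw⟩ := ih _ (.inp _)
      exact ⟨w, .back h hr, hw⟩
    | chan₂ h => exact ⟨_, .argChan h, .chan _⟩
    | call₂ h _ ih => exact ⟨_, .back h (.out (.lr _)), .arg ih⟩
    | back₃ h _ ih =>
      obtain ⟨w, hr, hw⟩ := ih
      exact .back h (.of_resume ⟨_, _, .out _, .arg (.rl _) hr⟩ hw)
    | chan₃ h => exact .argChan h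
  cases hs with
  | out u =>
    obtain ⟨w, hr, hw⟩ := key h _ (.out u)
    exact ⟨_, _, .out u, .of_resume ⟨_, _, .out _, hr⟩ hw⟩
  | chan s c =>
    cases s with
    | fst =>
      obtain ⟨w, hr, hw⟩ := key h _ (.chan c)
      exact ⟨_, _, .chan c, .of_resume ⟨_, _, .chan _, hr⟩ hw⟩
    | snd =>
      obtain ⟨w, hr, hw⟩ := key h
      exact ⟨_, _, .chan c, .of_resume ⟨_, _, .argChan _, hr⟩ hw⟩
    | trd => exact ⟨_, _, .argChan c, key h⟩

theorem bFun_law (f g z : NRel) : app (app (app (ofFun bFun) f) g) z = app f (app g z) := by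
  rw [bFun_app]
  funext p q
  refine propext ⟨fun h => ?_, fun h => ?_⟩
  · obtain ⟨s, x, hs, hr⟩ := BRun.of_app_bApp h
    exact hr.app_app hs
  · obtain ⟨s, x, hs, hr⟩ := BRun.of_app_app h
    exact hr.app_bApp hs

end B

section C

variable {f g z : NRel}

theorem CRun.of_run_inner {b : Bool} {x w : Node} (h : Run f z b x w) {q : Node}
    (hw : Resume (fun v => CRun f g z .snd (.inl v)) w q) :
    CRun f g z (bif b then .fst else .trd) x q := by
  induction h with
  | out h =>
    cases hw with
    | out u => exact .out h
    | arg hK => exact .call₂ h hK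
  | chan h => cases hw; exact .chan₁ h
  | arg h _ ih => exact .call₃ h (ih hw)
  | argChan h => cases hw; exact .chan₃ h
  | back h _ ih => exact .back₃ h (ih hw)

theorem CRun.of_app_app {p q : Node} (h : app (app f z) g p q) :
    ∃ s x, Start₃ (fun u => r (r u)) p s x ∧ CRun f g z s x q := by
  have key {b : Bool} {x q : Node} (h : Run (app f z) g b x q) :
      (b = true → ∃ b' x', Start x b' x' ∧ CRun f g z (bif b' then .fst else .trd) x' q) ∧
        (b = false → CRun f g z .snd x q) := by
    induction h with
    | out h =>
      obtain ⟨b', x', hs, hr⟩ := h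
      exact ⟨fun _ => ⟨b', x', hs, .of_run_inner hr (.out _)⟩, nofun⟩
    | chan h =>
      obtain ⟨b', x', hs, hr⟩ := h
      exact ⟨fun _ => ⟨b', x', hs, .of_run_inner hr (.chan _)⟩, nofun⟩
    | arg h _ ih =>
      obtain ⟨b', x', hs, hr⟩ := h
      exact ⟨fun _ => ⟨b', x', hs, .of_run_inner hr (.arg (ih.2 rfl))⟩, nofun⟩
    | argChan h => exact ⟨nofun, fun _ => .chan₂ h⟩
    | back h _ ih =>
      obtain ⟨b', x', hs, hr⟩ := ih.1 rfl
      cases hs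
      exact ⟨nofun, fun _ => .back₂ h hr⟩
  obtain ⟨b, x, hs, hr⟩ := h
  cases hs with
  | out u =>
    obtain ⟨b', x', hs, hr⟩ := (key hr).1 rfl
    cases hs
    exact ⟨_, _, .out u, hr⟩
  | chan c =>
    obtain ⟨b', x', hs, hr⟩ := (key hr).1 rfl
    cases hs with
    | chan => exact ⟨_, _, .chan _ c, hr⟩
    | argChan => exact ⟨_, _, .chan _ c, hr⟩
  | argChan c => exact ⟨_, _, .chan _ c, (key hr).2 rfl⟩

theorem CRun.app_app {p q x : Node} {s : Part} (hs : Start₃ (fun u => r (r u)) p s x)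
    (h : CRun f g z s x q) : app (app f z) g p q := by
  have key {s : Part} {x q : Node} (h : CRun f g z s x q) :
      match s with
      | .fst => ∃ w, Run f z true x w ∧
          Resume (fun v => Run (app f z) g false (.inl v)) w q
      | .snd => Run (app f z) g false x q
      | .trd => ∃ w, Run f z false x w ∧
          Resume (fun v => Run (app f z) g false (.inl v)) w q := by
    induction h with
    | out h => exact ⟨_, .out h, .out _⟩
    | chan₁ h => exact ⟨_, .chan h, .chan _⟩
    | call₂ h _ ih => exact ⟨_, .out h, .arg ih⟩
    | call₃ h _ ih =>
      obtain ⟨w, hr, hw⟩ := ih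
      exact ⟨w, .arg h hr, hw⟩
    | back₂ h _ ih =>
      obtain ⟨w, hr, hw⟩ := ih
      exact .back h (.of_resume ⟨_, _, .out _, hr⟩ hw)
    | chan₂ h => exact .argChan h
    | back₃ h _ ih =>
      obtain ⟨w, hr, hw⟩ := ih
      exact ⟨w, .back h hr, hw⟩
    | chan₃ h => exact ⟨_, .argChan h, .chan _⟩
  cases hs with
  | out u =>
    obtain ⟨w, hr, hw⟩ := key h
    exact ⟨_, _, .out u, .of_resume ⟨_, _, .out _, hr⟩ hw⟩
  | chan s c =>
    cases s with
    | fst =>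
      obtain ⟨w, hr, hw⟩ := key h
      exact ⟨_, _, .chan c, .of_resume ⟨_, _, .chan _, hr⟩ hw⟩
    | snd => exact ⟨_, _, .argChan c, key h⟩
    | trd =>
      obtain ⟨w, hr, hw⟩ := key h
      exact ⟨_, _, .chan c, .of_resume ⟨_, _, .argChan _, hr⟩ hw⟩

/-- `C f` is a pure relabelling of `f` without bypass edges, so every entry node is a port of `f`.
-/
theorem CRun.of_run_cApp {b : Bool} {x w : Node} (h : Run (CApp f) g b x w) :
    (b = true → ∃ a, CPort a x ∧ ∀ q, Resume (fun v => CRun f g z .trd (.inl v)) w q →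
        CRun f g z .fst a q) ∧
    (b = false → ∀ q, Resume (fun v => CRun f g z .trd (.inl v)) w q → CRun f g z .snd x q) := by
  induction h with
  | out h =>
    refine ⟨fun _ => ?_, nofun⟩
    cases h with
    | wrap ha hb h =>
      refine ⟨_, ha, fun q hq => ?_⟩
      cases hb <;> cases hq
      · exact .call₃ h ‹_›
      · exact .out h
  | chan h =>
    refine ⟨fun _ => ?_, nofun⟩
    cases h with
    | wrap ha hb h =>
      refine ⟨_, ha, fun q hq => ?_⟩
      cases hb
      cases hq
      exact .chan₁ h
  | arg h _ ih =>
    refine ⟨fun _ => ?_, nofun⟩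
    cases h with
    | wrap ha hb h =>
      cases hb
      exact ⟨_, ha, fun q hq => .call₂ h (ih.2 rfl q hq)⟩
  | argChan h =>
    refine ⟨nofun, fun _ q hq => ?_⟩
    cases hq
    exact .chan₂ h
  | back h _ ih =>
    refine ⟨nofun, fun _ q hq => ?_⟩
    obtain ⟨a, ha, hr⟩ := ih.1 rfl
    cases ha
    exact .back₂ h (hr q hq)

theorem CRun.of_app_cApp {p q : Node} (h : app (app (CApp f) g) z p q) :
    ∃ s x, Start₃ (fun u => r (r u)) p s x ∧ CRun f g z s x q := by
  have inner {p w q : Node} (h : app (CApp f) g p w)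
      (hw : Resume (fun v => CRun f g z .trd (.inl v)) w q) :
      (∃ u, p = .inl (r u) ∧ CRun f g z .fst (.inl (r (r u))) q) ∨
      (∃ v, p = .inl (l v) ∧ CRun f g z .fst p q) ∨
      ∃ c, p = .inr c ∧ (CRun f g z .fst p q ∨ CRun f g z .snd p q) := by
    obtain ⟨b, x, hs, hr⟩ := h
    have hrun := of_run_cApp (z := z) hr
    cases hs with
    | out u =>
      obtain ⟨a, ha, hq⟩ := hrun.1 rfl
      cases ha
      · exact Or.inr (Or.inl ⟨_, rfl, hq q hw⟩)
      · exact Or.inl ⟨_, rfl, hq q hw⟩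
    | chan c =>
      obtain ⟨a, ha, hq⟩ := hrun.1 rfl
      cases ha
      exact Or.inr (Or.inr ⟨c, rfl, Or.inl (hq q hw)⟩)
    | argChan c => exact Or.inr (Or.inr ⟨c, rfl, Or.inr (hrun.2 rfl q hw)⟩)
  have key {b : Bool} {x q : Node} (h : Run (app (CApp f) g) z b x q) :
      (b = true → ∃ w, app (CApp f) g x w ∧ Resume (fun v => CRun f g z .trd (.inl v)) w q) ∧
        (b = false → CRun f g z .trd x q) := by
    induction h with
    | out h => exact ⟨fun _ => ⟨_, h, .out _⟩, nofun⟩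
    | chan h => exact ⟨fun _ => ⟨_, h, .chan _⟩, nofun⟩
    | arg h _ ih => exact ⟨fun _ => ⟨_, h, .arg (ih.2 rfl)⟩, nofun⟩
    | argChan h => exact ⟨nofun, fun _ => .chan₃ h⟩
    | back h _ ih =>
      refine ⟨nofun, fun _ => ?_⟩
      obtain ⟨w, hr, hw⟩ := ih.1 rfl
      rcases inner hr hw with ⟨u, hu, hr⟩ | ⟨v, hv, hr⟩ | ⟨c, hc, hr⟩
      · cases hu
      · exact .back₃ h hr
      · cases hc
  obtain ⟨b, x, hs, hr⟩ := h
  cases hs with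
  | out u =>
    obtain ⟨w, hr, hw⟩ := (key hr).1 rfl
    rcases inner hr hw with ⟨u, hu, hr⟩ | ⟨v, hv, hr⟩ | ⟨c, hc, hr⟩
    · cases hu
      exact ⟨_, _, .out _, hr⟩
    · cases hv
    · cases hc
  | chan c =>
    obtain ⟨w, hr, hw⟩ := (key hr).1 rfl
    rcases inner hr hw with ⟨u, hu, hr⟩ | ⟨v, hv, hr⟩ | ⟨c, hc, hr | hr⟩
    · cases hu
    · cases hv
    · exact ⟨_, _, .chan _ _, hr⟩
    · exact ⟨_, _, .chan _ _, hr⟩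
  | argChan c => exact ⟨_, _, .chan _ c, (key hr).2 rfl⟩

theorem CRun.app_cApp {p q x : Node} {s : Part} (hs : Start₃ (fun u => r (r u)) p s x)
    (h : CRun f g z s x q) : app (app (CApp f) g) z p q := by
  have key {s : Part} {x q : Node} (h : CRun f g z s x q) :
      match s with
      | .fst => ∀ x', CPort x x' → ∃ w, Run (CApp f) g true x' w ∧
          Resume (fun v => Run (app (CApp f) g) z false (.inl v)) w q
      | .snd => ∃ w, Run (CApp f) g false x w ∧
          Resume (fun v => Run (app (CApp f) g) z false (.inl v)) w q
      | .trd => Run (app (CApp f) g) z false x q := by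
    induction h with
    | out h => exact fun x' hx => ⟨_, .out (.wrap hx (.out _) h), .out _⟩
    | chan₁ h => exact fun x' hx => ⟨_, .chan (.wrap hx (.chan _) h), .chan _⟩
    | call₂ h _ ih =>
      intro x' hx
      obtain ⟨w, hr, hw⟩ := ih
      exact ⟨w, .arg (.wrap hx (.snd _) h) hr, hw⟩
    | call₃ h _ ih => exact fun x' hx => ⟨_, .out (.wrap hx (.fst _) h), .arg ih⟩
    | back₂ h _ ih =>
      obtain ⟨w, hr, hw⟩ := ih _ (.snd _)
      exact ⟨w, .back h hr, hw⟩
    | chan₂ h => exact ⟨_, .argChan h, .chan _⟩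
    | back₃ h _ ih =>
      obtain ⟨w, hr, hw⟩ := ih _ (.fst _)
      exact .back h (.of_resume ⟨_, _, .out _, hr⟩ hw)
    | chan₃ h => exact .argChan h
  cases hs with
  | out u =>
    obtain ⟨w, hr, hw⟩ := key h _ (.out u)
    exact ⟨_, _, .out u, .of_resume ⟨_, _, .out _, hr⟩ hw⟩
  | chan s c =>
    cases s with
    | fst =>
      obtain ⟨w, hr, hw⟩ := key h _ (.chan c)
      exact ⟨_, _, .chan c, .of_resume ⟨_, _, .chan _, hr⟩ hw⟩
    | snd =>
      obtain ⟨w, hr, hw⟩ := key h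
      exact ⟨_, _, .chan c, .of_resume ⟨_, _, .argChan _, hr⟩ hw⟩
    | trd => exact ⟨_, _, .argChan c, key h⟩

theorem cFun_law (f g z : NRel) : app (app (app (ofFun cFun) f) g) z = app (app f z) g := by
  rw [cFun_app]
  funext p q
  refine propext ⟨fun h => ?_, fun h => ?_⟩
  · obtain ⟨s, x, hs, hr⟩ := CRun.of_app_cApp h
    exact hr.app_app hs
  · obtain ⟨s, x, hs, hr⟩ := CRun.of_app_app h
    exact hr.app_cApp hs

end C

/-! ### Fresh channels, visibility, and the stable model of relations. -/

/-- The channel of a node, if any, has an index below `n`. -/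
def NodeBdd (n : ℕ) : Node → Prop
  | .inl _ => True
  | .inr c => c.1 < n

/-- All channels used have indices below `n`. -/
def Bdd (n : ℕ) (f : NRel) : Prop := ∀ p q, f p q → NodeBdd n p ∧ NodeBdd n q

theorem NodeBdd.mono {n k : ℕ} (hk : n ≤ k) {p : Node} (h : NodeBdd n p) : NodeBdd k p := by
  cases p with
  | inl u => trivial
  | inr c => exact lt_of_lt_of_le h hk

theorem Bdd.mono {n k : ℕ} {f : NRel} (h : Bdd n f) (hk : n ≤ k) : Bdd k f :=
  fun p q hpq => ⟨(h p q hpq).1.mono hk, (h p q hpq).2.mono hk⟩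

theorem Bdd.app {n : ℕ} {f g : NRel} (hf : Bdd n f) (hg : Bdd n g) : Bdd n (app f g) := by
  have key {b : Bool} {x q : Node} (h : Run f g b x q) : NodeBdd n x ∧ NodeBdd n q := by
    induction h with
    | out h => exact ⟨(hf _ _ h).1, trivial⟩
    | chan h => exact hf _ _ h
    | arg h _ ih => exact ⟨(hf _ _ h).1, ih.2⟩
    | argChan h => exact hg _ _ h
    | back h _ ih => exact ⟨(hg _ _ h).1, ih.2⟩
  rintro p q ⟨b, x, hs, hr⟩
  refine ⟨?_, (key hr).2⟩
  cases hs with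
  | out u => trivial
  | chan c => exact (key hr).1
  | argChan c => exact (key hr).1

theorem bdd_ofFun (n : ℕ) (h : Move → Option Move) : Bdd n (ofFun h) := by
  rintro (u | c) (v | d) hpq
  · exact ⟨trivial, trivial⟩
  all_goals exact hpq.elim

def combFun : Comb .linear → Move → Option Move
  | .B => bFun
  | .C => cFun
  | .I => iFun

/-- The algebra of the relations that use finitely many channels. -/
def alg : CombStr .linear {f : NRel // ∃ n, Bdd n f} where
  app f g := ⟨app f.1 g.1, by
    obtain ⟨n, hn⟩ := f.2
    obtain ⟨k, hk⟩ := g.2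
    exact ⟨max n k, (hn.mono (le_max_left _ _)).app (hk.mono (le_max_right _ _))⟩⟩
  comb c := ⟨ofFun (combFun c), 0, bdd_ofFun _ _⟩

/-- The argument that is wired to the `n`-th channel. -/
inductive Wire (n : ℕ) : NRel
  | send (u) : Wire n (.inl u) (.inr (n, u))
  | receive (u) : Wire n (.inr (n, u)) (.inl u)

/-- `Port n a p`: the node `a` of `f` appears as the node `p` of `f` applied to `Wire n`. -/
inductive Port (n : ℕ) : Node → Node → Prop
  | inp (u) : Port n (.inl (l u)) (.inr (n, u))
  | out (u) : Port n (.inl (r u)) (.inl u)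
  | chan {c} : c.1 < n → Port n (.inr c) (.inr c)

theorem bdd_wire (n : ℕ) : Bdd (n + 1) (Wire n) := by
  rintro p q (_ | _) <;> simp [NodeBdd]

theorem Port.unique {n : ℕ} {a a' p : Node} (h : Port n a p) (h' : Port n a' p) : a = a' := by
  cases h with
  | inp u =>
    cases h' with
    | inp => rfl
    | chan h => exact absurd h (lt_irrefl n)
  | out u => cases h'; rfl
  | chan h =>
    cases h' with
    | inp => exact absurd h (lt_irrefl n)
    | chan => rfl

theorem Port.exists {n : ℕ} {a : Node} (h : Visible a) (ha : NodeBdd n a) : ∃ p, Port n a p := by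
  cases h with
  | l u => exact ⟨_, .inp u⟩
  | r u => exact ⟨_, .out u⟩
  | chan c => exact ⟨_, .chan ha⟩

/-- Applied to a fresh channel, a relation can be read off. -/
theorem app_wire {n : ℕ} {f : NRel} (hf : Bdd n f) {a b p q : Node} (ha : Port n a p)
    (hb : Port n b q) : app f (Wire n) p q ↔ f a b := by
  -- `Wire n` has no edge between two moves, so a token sent to the argument leaves through channel
  -- `n` at once and the run is a single edge of `f`.
  have hrun {a q : Node} : Run f (Wire n) true a q ↔ ∃ b, f a b ∧ Port n b q := by
    constructor
    · rintro (h | h | h)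
      · exact ⟨_, h, .out _⟩
      · exact ⟨_, h, .chan (hf _ _ h).2⟩
      · refine ⟨_, h, ?_⟩
        rename_i hr
        cases hr with
        | argChan h => cases h; exact .inp _
        | back h => cases h
    · rintro ⟨b, h, hb⟩
      cases hb with
      | inp u => exact .arg h (.argChan (.send u))
      | out u => exact .out h
      | chan _ => exact .chan h
  constructor
  · rintro ⟨b', x, hs, hr⟩
    have : Run f (Wire n) true a q := by
      cases hs with
      | out u => cases ha; exact hr
      | chan c =>
        cases ha with
        | chan _ => exact hr
        | inp u =>
          obtain ⟨b, h, _⟩ := hrun.1 hr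
          exact absurd (hf _ _ h).1 (lt_irrefl n)
      | argChan c =>
        cases hr with
        | argChan h => cases h
        | back h hr =>
          cases h
          cases ha with
          | inp => exact hr
          | chan h => exact absurd h (lt_irrefl n)
    obtain ⟨b', h, hb'⟩ := hrun.1 this
    rwa [hb.unique hb']
  · intro h
    have hr : Run f (Wire n) true a q := hrun.2 ⟨b, h, hb⟩
    cases ha with
    | inp u => exact ⟨_, _, .argChan _, .back (.receive u) hr⟩
    | out u => exact ⟨_, _, .out u, hr⟩
    | chan _ => exact ⟨_, _, .chan _, hr⟩

/-- `ε f` is `f` restricted to visible nodes, and a run enters and leaves `f` at visible nodes only.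
-/
theorem eFun_app_app (f g : NRel) : app (app (ofFun eFun) f) g = app f g := by
  have key (b : Bool) (x q : Node) (hx : b = true → Visible x) :
      Run (app (ofFun eFun) f) g b x q ↔ Run f g b x q := by
    constructor
    · intro h
      clear hx
      induction h with
      | out h => exact .out (eFun_app.1 h).1
      | chan h => exact .chan (eFun_app.1 h).1
      | arg h _ ih => exact .arg (eFun_app.1 h).1 ih
      | argChan h => exact .argChan h
      | back h _ ih => exact .back h ih
    · intro h
      induction h with
      | out h => exact .out (eFun_app.2 ⟨h, hx rfl, .r _⟩)
      | chan h => exact .chan (eFun_app.2 ⟨h, hx rfl, .chan _⟩)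
      | arg h _ ih => exact .arg (eFun_app.2 ⟨h, hx rfl, .l _⟩) (ih nofun)
      | argChan h => exact .argChan h
      | back h _ ih => exact .back h (ih fun _ => .l _)
  funext p q
  refine propext (exists_congr fun b => exists_congr fun x =>
    and_congr_right fun hs => key b x q ?_)
  rintro rfl
  cases hs with
  | out u => exact .r u
  | chan c => exact .chan c

/-- If `f` takes and gives results at visible nodes only, then `app f g` is visible. -/
theorem app_visible {f g : NRel} (hin : ∀ u w, f (.inl (r u)) w → Visible (.inl u))
    (hout : ∀ x u, f x (.inl (r u)) → Visible (.inl u)) (p q : Node) (h : app f g p q) :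
    Visible p ∧ Visible q := by
  have key {b : Bool} {x q : Node} (h : Run f g b x q) : Visible q := by
    induction h with
    | out h => exact hout _ _ h
    | chan h => exact .chan _
    | arg _ _ ih => exact ih
    | argChan h => exact .chan _
    | back _ _ ih => exact ih
  obtain ⟨b, x, hs, hr⟩ := h
  refine ⟨?_, key hr⟩
  cases hs with
  | out u =>
    cases hr with
    | out h => exact hin _ _ h
    | chan h => exact hin _ _ h
    | arg h => exact hin _ _ h
  | chan c => exact .chan c
  | argChan c => exact .chan c

theorem ofFun_visible {h : Move → Option Move}
    (hh : ∀ u v, h u = some v → Visible (.inl u) ∧ Visible (.inl v)) (p q : Node)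
    (hpq : ofFun h p q) : Visible p ∧ Visible q := by
  rcases p with u | c <;> rcases q with v | d
  · exact hh u v hpq
  all_goals exact hpq.elim

theorem combFun_visible (c : Comb .linear) (u v : Move) (h : combFun c u = some v) :
    Visible (.inl u) ∧ Visible (.inl v) := by
  cases c <;> simp only [combFun] at h
  · revert h
    fun_cases bFun u <;> rintro ⟨⟩ <;> exact ⟨by constructor, by constructor⟩
  · revert h
    fun_cases cFun u <;> rintro ⟨⟩ <;> exact ⟨by constructor, by constructor⟩
  · revert h
    fun_cases iFun u <;> rintro ⟨⟩ <;> exact ⟨by constructor, by constructor⟩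

theorem BPort.visible {a p : Node} (h : BPort a p) : Visible p := by
  cases h <;> constructor

theorem CPort.visible {a p : Node} (h : CPort a p) : Visible p := by
  cases h <;> constructor

theorem BApp.visible {f : NRel} (p q : Node) (h : BApp f p q) : Visible p ∧ Visible q := by
  cases h with
  | wrap ha hb => exact ⟨ha.visible, hb.visible⟩
  | lr => exact ⟨.l _, .r _⟩
  | rl => exact ⟨.r _, .l _⟩

theorem CApp.visible {f : NRel} (p q : Node) (h : CApp f p q) : Visible p ∧ Visible q := by
  cases h with
  | wrap ha hb => exact ⟨ha.visible, hb.visible⟩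

theorem BApp.app_visible {f g : NRel} : ∀ p q, app (BApp f) g p q → Visible p ∧ Visible q := by
  refine NRel.app_visible ?_ ?_
  · intro u w h
    cases h with
    | wrap ha => cases ha; constructor
    | rl => constructor
  · intro x u h
    cases h with
    | wrap _ hb => cases hb; constructor
    | lr => constructor

theorem CApp.app_visible {f g : NRel} : ∀ p q, app (CApp f) g p q → Visible p ∧ Visible q := by
  refine NRel.app_visible ?_ ?_
  · intro u w h
    cases h with
    | wrap ha => cases ha <;> constructor
  · intro x u h
    cases h with
    | wrap _ hb => cases hb <;> constructor

theorem alg_isStableModel : alg.IsStableModel ⟨ofFun eFun, 0, bdd_ofFun _ _⟩ where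
  isCombAlgebra c := by
    cases c with
    | B => exact fun x y z => Subtype.ext (bFun_law _ _ _)
    | C => exact fun x y z => Subtype.ext (cFun_law _ _ _)
    | I => exact fun x => Subtype.ext (iFun_app _)
  app_app x y := Subtype.ext (eFun_app_app _ _)
  weakExt := by
    rintro ⟨x, k, hx⟩ ⟨y, m, hy⟩ h
    replace hx := hx.mono (le_max_left k m)
    replace hy := hy.mono (le_max_right k m)
    -- Both relations use only channels below `max k m`, so this channel is fresh for both and
    -- `app_wire` recovers their edges between visible nodes.
    have hw : app x (Wire (max k m)) = app y (Wire (max k m)) :=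
      congrArg Subtype.val (h ⟨Wire (max k m), _, bdd_wire _⟩)
    refine Subtype.ext ?_
    funext p q
    refine propext (eFun_app.trans (Iff.trans ?_ eFun_app.symm))
    refine and_congr_left fun hv => ?_
    change x p q ↔ y p q
    have key (hp : NodeBdd (max k m) p) (hq : NodeBdd (max k m) q) : x p q ↔ y p q := by
      obtain ⟨p', hp⟩ := Port.exists hv.1 hp
      obtain ⟨q', hq⟩ := Port.exists hv.2 hq
      rw [← app_wire hx hp hq, ← app_wire hy hp hq, hw]
    exact ⟨fun h => (key (hx p q h).1 (hx p q h).2).1 h,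
      fun h => (key (hy p q h).1 (hy p q h).2).2 h⟩
  fixed c := by
    have hc := eFun_app_eq_self (ofFun_visible (combFun_visible c))
    cases c with
    | B =>
      refine ⟨Subtype.ext hc, fun x => Subtype.ext (eFun_app_eq_self ?_),
        fun x y => Subtype.ext (eFun_app_eq_self ?_)⟩
      · change ∀ p q, app (ofFun bFun) x.1 p q → _
        rw [bFun_app]
        exact BApp.visible
      · change ∀ p q, app (app (ofFun bFun) x.1) y.1 p q → _
        rw [bFun_app]
        exact BApp.app_visible
    | C =>
      refine ⟨Subtype.ext hc, fun x => Subtype.ext (eFun_app_eq_self ?_),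
        fun x y => Subtype.ext (eFun_app_eq_self ?_)⟩
      · change ∀ p q, app (ofFun cFun) x.1 p q → _
        rw [cFun_app]
        exact CApp.visible
      · change ∀ p q, app (app (ofFun cFun) x.1) y.1 p q → _
        rw [cFun_app]
        exact CApp.app_visible
    | I => exact Subtype.ext hc

end NRel

/-! ### Embedding of the partial involutions into the relations with channels. -/

namespace PInv

open Move Relation

/-- A partial involution as a relation that uses no channels. -/
def toNRel (f : PInv) : NRel
  | .inl u, .inl v => f.rel u v
  | _, _ => False

theorem bdd_toNRel (f : PInv) : NRel.Bdd 0 f.toNRel := by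
  rintro (u | c) (v | d) h
  · exact ⟨trivial, trivial⟩
  all_goals exact h.elim

theorem toNRel_injective : Function.Injective toNRel := by
  intro f g h
  ext u v
  exact iff_of_eq (congrFun (congrFun h (.inl u)) (.inl v))

/-- Without channels, a run alternates between `f` and `g` and unrolls to the path in the execution
formula. Runs are built from their starting point, so the closure is decomposed at its head. -/
theorem toNRel_app (f g : PInv) : (f.app g).toNRel = NRel.app f.toNRel g.toNRel := by
  have hrun {b : Bool} {x q : Node} (h : NRel.Run f.toNRel g.toNRel b x q) :
      (b = true → ∀ u, x = .inl u → ∃ v, q = .inl v ∧ (f.rel u (r v) ∨ ∃ w, f.rel u (l w) ∧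
        Comp (Comp g.rel (ReflTransGen (Comp (f.sub l l) g.rel))) (f.sub l r) w v)) ∧
      (b = false → ∀ u, x = .inl u → ∃ v, q = .inl v ∧
        Comp (Comp g.rel (ReflTransGen (Comp (f.sub l l) g.rel))) (f.sub l r) u v) := by
    induction h with
    | out h =>
      refine ⟨fun _ u hu => ?_, nofun⟩
      subst hu
      exact ⟨_, rfl, Or.inl h⟩
    | chan h =>
      refine ⟨fun _ u hu => ?_, nofun⟩
      subst hu
      exact h.elim
    | arg h _ ih =>
      refine ⟨fun _ u hu => ?_, nofun⟩
      subst hu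
      obtain ⟨v, rfl, hv⟩ := ih.2 rfl _ rfl
      exact ⟨v, rfl, Or.inr ⟨_, h, hv⟩⟩
    | argChan h =>
      refine ⟨nofun, fun _ u hu => ?_⟩
      subst hu
      exact h.elim
    | back h _ ih =>
      refine ⟨nofun, fun _ u hu => ?_⟩
      subst hu
      obtain ⟨v, rfl, hv | ⟨w, hw, c, ⟨b, hwb, hbc⟩, hcv⟩⟩ := ih.1 rfl _ rfl
      · exact ⟨v, rfl, _, ⟨_, h, .refl⟩, hv⟩
      · exact ⟨v, rfl, c, ⟨_, h, .head ⟨w, hw, hwb⟩ hbc⟩, hcv⟩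
  have hback {b c v : Move} (hs : ReflTransGen (Comp (f.sub l l) g.rel) b c)
      (hv : f.sub l r c v) : NRel.Run f.toNRel g.toNRel true (.inl (l b)) (.inl v) := by
    induction hs using ReflTransGen.head_induction_on with
    | refl => exact .out hv
    | head h _ ih =>
      obtain ⟨w, hw, hw'⟩ := h
      exact .arg hw (.back (show g.toNRel _ (.inl _) from hw') ih)
  funext p q
  refine propext ⟨fun h => ?_, ?_⟩
  · rcases p with u | c <;> rcases q with v | d
    · refine ⟨_, _, .out u, ?_⟩
      rcases (show f.appRel g u v from h) with h | ⟨c, ⟨b, ⟨a, hua, hab⟩, hbc⟩, hcv⟩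
      · exact .out h
      · exact .arg hua (.back (show g.toNRel _ (.inl _) from hab) (hback hbc hcv))
    all_goals exact h.elim
  · rintro ⟨b, x, hs, hr⟩
    cases hs with
    | out u =>
      obtain ⟨v, rfl, h | ⟨a, hua, c, ⟨b, hab, hbc⟩, hcv⟩⟩ := (hrun hr).1 rfl _ rfl
      · exact Or.inl h
      · exact Or.inr ⟨c, ⟨b, ⟨a, hua, hab⟩, hbc⟩, hcv⟩
    | chan c =>
      cases hr with
      | out h => exact h.elim
      | chan h => exact h.elim
      | arg h => exact h.elim
    | argChan c =>
      cases hr with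
      | argChan h => exact h.elim
      | back h => exact h.elim

theorem B_rel {u v : Move} : B.rel u v ↔ NRel.bFun u = some v := by
  constructor
  · rintro (h | h) <;> cases h <;> rfl
  · intro h
    revert h
    fun_cases NRel.bFun u <;> rintro ⟨⟩
    · exact Or.inl (.one _)
    · exact Or.inr (.one _)
    · exact Or.inl (.two _)
    · exact Or.inr (.two _)
    · exact Or.inl (.three _)
    · exact Or.inr (.three _)

theorem C_rel {u v : Move} : C.rel u v ↔ NRel.cFun u = some v := by
  constructor
  · rintro (h | h) <;> cases h <;> rfl
  · intro h
    revert h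
    fun_cases NRel.cFun u <;> rintro ⟨⟩
    · exact Or.inl (.one _)
    · exact Or.inr (.one _)
    · exact Or.inl (.two _)
    · exact Or.inr (.two _)
    · exact Or.inl (.three _)
    · exact Or.inr (.three _)

theorem I_rel {u v : Move} : I.rel u v ↔ NRel.iFun u = some v := by
  constructor
  · rintro (h | h) <;> cases h <;> rfl
  · intro h
    revert h
    fun_cases NRel.iFun u <;> rintro ⟨⟩
    · exact Or.inl (.one _)
    · exact Or.inr (.one _)

theorem toNRel_eq_ofFun {f : PInv} {h : Move → Option Move}
    (hf : ∀ {u v}, f.rel u v ↔ h u = some v) : f.toNRel = NRel.ofFun h := by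
  funext p q
  rcases p with u | c <;> rcases q with v | d
  · exact propext hf
  all_goals rfl

theorem alg_isLambdaAlgebra : alg.IsLambdaAlgebra := by
  refine NRel.alg_isStableModel.isLambdaAlgebra_of_embedding
    (i := fun f : PInv => ⟨f.toNRel, 0, f.bdd_toNRel⟩) ?_ ?_ ?_
  · intro f g h
    exact toNRel_injective (congrArg Subtype.val h)
  · exact fun f g => Subtype.ext (toNRel_app f g)
  · intro c
    cases c with
    | B => exact Subtype.ext (toNRel_eq_ofFun B_rel)
    | C => exact Subtype.ext (toNRel_eq_ofFun C_rel)
    | I => exact Subtype.ext (toNRel_eq_ofFun I_rel)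

end PInv

/-! ### The affine case: graded sets of tokens. -/

/-- Tokens: atoms, constant arrows (the argument is not used) and arrows. -/
inductive Token : Type
  | atom : Token
  | const (b : Token) : Token
  | arr (a b : Token) : Token

/-- Sets of tokens graded by multisets of indeterminates, that is, formal sums of tokens with
coefficients in the semiring of sets of monomials. -/
abbrev GSet : Type := Token → Multiset ℕ → Prop

namespace GSet

/-- Formal affine application. -/
def app (f g : GSet) : GSet := fun b s =>
  f (.const b) s ∨ ∃ a s₁ s₂, f (.arr a b) s₁ ∧ g a s₂ ∧ s₁ + s₂ = s

/-- All indeterminates in the grades are below `n`. -/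
def Bdd (n : ℕ) (f : GSet) : Prop := ∀ a s, f a s → ∀ i ∈ s, i < n

theorem Bdd.mono {n k : ℕ} {f : GSet} (h : Bdd n f) (hk : n ≤ k) : Bdd k f :=
  fun a s hs i hi => (h a s hs i hi).trans_le hk

theorem Bdd.app {n : ℕ} {f g : GSet} (hf : Bdd n f) (hg : Bdd n g) : Bdd n (f.app g) := by
  rintro b _ (h | ⟨a, s₁, s₂, h₁, h₂, rfl⟩) i hi
  · exact hf _ _ h i hi
  · rcases Multiset.mem_add.1 hi with hi | hi
    · exact hf _ _ h₁ i hi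
    · exact hg _ _ h₂ i hi

/-- A set of tokens, placed in the trivial grade. -/
def pure (p : Token → Prop) : GSet := fun a s => p a ∧ s = 0

theorem bdd_pure (n : ℕ) (p : Token → Prop) : Bdd n (pure p) := by
  rintro a _ ⟨_, rfl⟩ i hi
  simp at hi

/-- One rule for each way in which `x (y z)` can use its arguments: `x` ignores `y z`; `x` uses it
but `y` ignores `z`; all three are used. `CTok` treats `(x z) y` likewise. -/
inductive BTok : Token → Prop
  | const (b : Token) : BTok (.arr (.const b) (.const (.const b)))
  | left (c b : Token) : BTok (.arr (.arr c b) (.arr (.const c) (.const b)))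
  | arr (a b c : Token) : BTok (.arr (.arr c b) (.arr (.arr a c) (.arr a b)))

inductive CTok : Token → Prop
  | const (b : Token) : CTok (.arr (.const (.const b)) (.const (.const b)))
  | left (a b : Token) : CTok (.arr (.arr a (.const b)) (.const (.arr a b)))
  | right (c b : Token) : CTok (.arr (.const (.arr c b)) (.arr c (.const b)))
  | arr (a b c : Token) : CTok (.arr (.arr a (.arr c b)) (.arr c (.arr a b)))

inductive ITok : Token → Prop
  | mk (b : Token) : ITok (.arr b b)

inductive KTok : Token → Prop
  | mk (b : Token) : KTok (.arr b (.const b))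

/-- The identity on the tokens that application can read from a function; only the atom is lost. -/
inductive ETok : Token → Prop
  | const (b : Token) : ETok (.arr (.const b) (.const b))
  | arr (a b : Token) : ETok (.arr (.arr a b) (.arr a b))

def combTok : Comb .affine → Token → Prop
  | .B => BTok
  | .C => CTok
  | .I => ITok
  | .K => KTok

theorem app_const {f g : GSet} {b : Token} {s : Multiset ℕ} (h : f (.const b) s) :
    f.app g b s := Or.inl h

theorem app_arr {f g : GSet} {a b : Token} {s₁ s₂ : Multiset ℕ} (h₁ : f (.arr a b) s₁)
    (h₂ : g a s₂) : f.app g b (s₁ + s₂) := Or.inr ⟨a, s₁, s₂, h₁, h₂, rfl⟩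

theorem pure_app {p : Token → Prop} {g : GSet} {b : Token} {s : Multiset ℕ} :
    (pure p).app g b s ↔ (p (.const b) ∧ s = 0) ∨ ∃ a, p (.arr a b) ∧ g a s := by
  constructor
  · rintro (h | ⟨a, _, s₂, ⟨h, rfl⟩, hg, rfl⟩)
    · exact Or.inl h
    · exact Or.inr ⟨a, h, by simpa using hg⟩
  · rintro (h | ⟨a, h, hg⟩)
    · exact Or.inl h
    · simpa using app_arr (f := pure p) ⟨h, rfl⟩ hg

theorem ITok_app (x : GSet) : (pure ITok).app x = x := by
  funext b s
  refine propext (pure_app.trans ⟨?_, fun h => Or.inr ⟨b, .mk b, h⟩⟩)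
  rintro (⟨⟨⟩, _⟩ | ⟨a, ⟨⟩, h⟩)
  exact h

theorem KTok_app {x : GSet} {t : Token} {s : Multiset ℕ} :
    (pure KTok).app x t s ↔ ∃ b, t = .const b ∧ x b s := by
  refine pure_app.trans ⟨?_, ?_⟩
  · rintro (⟨⟨⟩, _⟩ | ⟨a, ⟨⟩, h⟩)
    exact ⟨a, rfl, h⟩
  · rintro ⟨b, rfl, h⟩
    exact Or.inr ⟨b, .mk b, h⟩

theorem KTok_app_app (x y : GSet) : ((pure KTok).app x).app y = x := by
  funext b s
  refine propext ⟨?_, fun h => Or.inl (KTok_app.2 ⟨b, rfl, h⟩)⟩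
  rintro (h | ⟨a, s₁, s₂, h, _⟩)
  · obtain ⟨_, ⟨⟩, h⟩ := KTok_app.1 h
    exact h
  · obtain ⟨_, ⟨⟩, _⟩ := KTok_app.1 h

theorem ETok_app {x : GSet} {t : Token} {s : Multiset ℕ} :
    (pure ETok).app x t s ↔ t ≠ .atom ∧ x t s := by
  refine pure_app.trans ⟨?_, ?_⟩
  · rintro (⟨⟨⟩, _⟩ | ⟨a, ⟨⟩, h⟩) <;> exact ⟨by simp, h⟩
  · rintro ⟨ht, h⟩
    cases t with
    | atom => exact absurd rfl ht
    | const b => exact Or.inr ⟨_, .const b, h⟩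
    | arr a b => exact Or.inr ⟨_, .arr a b, h⟩

theorem ETok_app_eq_self {x : GSet} (h : ∀ s, ¬ x .atom s) : (pure ETok).app x = x := by
  funext t s
  refine propext (ETok_app.trans ⟨And.right, fun hx => ⟨?_, hx⟩⟩)
  rintro rfl
  exact h s hx

theorem ETok_app_app (x y : GSet) : ((pure ETok).app x).app y = x.app y := by
  funext b s
  rw [app]
  simp only [ETok_app]
  simp [app]

theorem BTok_app {x : GSet} {t : Token} {s : Multiset ℕ} :
    (pure BTok).app x t s ↔
      (∃ b, t = .const (.const b) ∧ x (.const b) s) ∨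
      (∃ c b, t = .arr (.const c) (.const b) ∧ x (.arr c b) s) ∨
      ∃ a b c, t = .arr (.arr a c) (.arr a b) ∧ x (.arr c b) s := by
  refine pure_app.trans ⟨?_, ?_⟩
  · rintro (⟨⟨⟩, _⟩ | ⟨a, ⟨⟩, h⟩)
    · exact Or.inl ⟨_, rfl, h⟩
    · exact Or.inr (Or.inl ⟨_, _, rfl, h⟩)
    · exact Or.inr (Or.inr ⟨_, _, _, rfl, h⟩)
  · rintro (⟨b, rfl, h⟩ | ⟨c, b, rfl, h⟩ | ⟨a, b, c, rfl, h⟩)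
    · exact Or.inr ⟨_, .const b, h⟩
    · exact Or.inr ⟨_, .left c b, h⟩
    · exact Or.inr ⟨_, .arr a b c, h⟩

theorem BTok_app_app {x y : GSet} {t : Token} {s : Multiset ℕ} :
    ((pure BTok).app x).app y t s ↔
      (∃ b, t = .const b ∧ x (.const b) s) ∨
      (∃ c b s₁ s₂, t = .const b ∧ x (.arr c b) s₁ ∧ y (.const c) s₂ ∧ s₁ + s₂ = s) ∨
      ∃ a b c s₁ s₂, t = .arr a b ∧ x (.arr c b) s₁ ∧ y (.arr a c) s₂ ∧ s₁ + s₂ = s := by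
  rw [app]
  simp only [BTok_app]
  aesop

theorem BTok_law (x y z : GSet) : (((pure BTok).app x).app y).app z = x.app (y.app z) := by
  funext t s
  refine propext ⟨?_, ?_⟩
  · rintro (h | ⟨a, s₁, s₂, h, hz, rfl⟩)
    · rcases BTok_app_app.1 h with ⟨b, ⟨⟩, h⟩ | ⟨c, b, s₁, s₂, ⟨⟩, h₁, h₂, rfl⟩ |
        ⟨_, _, _, _, _, ⟨⟩, _⟩
      · exact app_const h
      · exact app_arr h₁ (app_const h₂)
    · rcases BTok_app_app.1 h with ⟨b, ⟨⟩, h⟩ | ⟨_, _, _, _, ⟨⟩, _⟩ |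
        ⟨_, _, c, s₁, s₂, ⟨⟩, h₁, h₂, rfl⟩
      rw [add_assoc]
      exact app_arr h₁ (app_arr h₂ hz)
  · rintro (h | ⟨c, s₁, s₂, h, h' | ⟨a, s₃, s₄, h₃, h₄, rfl⟩, rfl⟩)
    · exact app_const (BTok_app_app.2 (Or.inl ⟨_, rfl, h⟩))
    · exact app_const (BTok_app_app.2 (Or.inr (Or.inl ⟨_, _, _, _, rfl, h, h', rfl⟩)))
    · rw [← add_assoc]
      exact app_arr (BTok_app_app.2 (Or.inr (Or.inr ⟨_, _, _, _, _, rfl, h, h₃, rfl⟩))) h₄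

theorem CTok_app {x : GSet} {t : Token} {s : Multiset ℕ} :
    (pure CTok).app x t s ↔
      (∃ b, t = .const (.const b) ∧ x (.const (.const b)) s) ∨
      (∃ a b, t = .const (.arr a b) ∧ x (.arr a (.const b)) s) ∨
      (∃ c b, t = .arr c (.const b) ∧ x (.const (.arr c b)) s) ∨
      ∃ a b c, t = .arr c (.arr a b) ∧ x (.arr a (.arr c b)) s := by
  refine pure_app.trans ⟨?_, ?_⟩
  · rintro (⟨⟨⟩, _⟩ | ⟨a, ⟨⟩, h⟩)
    · exact Or.inl ⟨_, rfl, h⟩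
    · exact Or.inr (Or.inl ⟨_, _, rfl, h⟩)
    · exact Or.inr (Or.inr (Or.inl ⟨_, _, rfl, h⟩))
    · exact Or.inr (Or.inr (Or.inr ⟨_, _, _, rfl, h⟩))
  · rintro (⟨b, rfl, h⟩ | ⟨a, b, rfl, h⟩ | ⟨c, b, rfl, h⟩ | ⟨a, b, c, rfl, h⟩)
    · exact Or.inr ⟨_, .const b, h⟩
    · exact Or.inr ⟨_, .left a b, h⟩
    · exact Or.inr ⟨_, .right c b, h⟩
    · exact Or.inr ⟨_, .arr a b c, h⟩

theorem CTok_app_app {x y : GSet} {t : Token} {s : Multiset ℕ} :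
    ((pure CTok).app x).app y t s ↔
      (∃ b, t = .const b ∧ x (.const (.const b)) s) ∨
      (∃ a b, t = .arr a b ∧ x (.arr a (.const b)) s) ∨
      (∃ c b s₁ s₂, t = .const b ∧ x (.const (.arr c b)) s₁ ∧ y c s₂ ∧ s₁ + s₂ = s) ∨
      ∃ a b c s₁ s₂, t = .arr a b ∧ x (.arr a (.arr c b)) s₁ ∧ y c s₂ ∧ s₁ + s₂ = s := by
  rw [app]
  simp only [CTok_app]
  aesop

theorem CTok_law (x y z : GSet) : (((pure CTok).app x).app y).app z = (x.app z).app y := by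
  funext t s
  refine propext ⟨?_, ?_⟩
  · rintro (h | ⟨a, s₁, s₂, h, hz, rfl⟩)
    · rcases CTok_app_app.1 h with ⟨b, ⟨⟩, h⟩ | ⟨_, _, ⟨⟩, _⟩ |
        ⟨c, b, s₁, s₂, ⟨⟩, h₁, h₂, rfl⟩ | ⟨_, _, _, _, _, ⟨⟩, _⟩
      · exact app_const (app_const h)
      · exact app_arr (app_const h₁) h₂
    · rcases CTok_app_app.1 h with ⟨b, ⟨⟩, h⟩ | ⟨_, _, ⟨⟩, h⟩ |
        ⟨_, _, _, _, ⟨⟩, _⟩ | ⟨_, _, c, s₁, s₂, ⟨⟩, h₁, h₂, rfl⟩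
      · exact app_const (app_arr h hz)
      · rw [add_right_comm]
        exact app_arr (app_arr h₁ hz) h₂
  · rintro ((h | ⟨a, s₃, s₄, h₃, h₄, rfl⟩) | ⟨c, s₁, s₂, h | ⟨a, s₃, s₄, h₃, h₄, rfl⟩, hy, rfl⟩)
    · exact app_const (CTok_app_app.2 (Or.inl ⟨_, rfl, h⟩))
    · exact app_arr (CTok_app_app.2 (Or.inr (Or.inl ⟨_, _, rfl, h₃⟩))) h₄
    · exact app_const
        (CTok_app_app.2 (Or.inr (Or.inr (Or.inl ⟨_, _, _, _, rfl, h, hy, rfl⟩))))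
    · rw [add_right_comm]
      exact app_arr
        (CTok_app_app.2 (Or.inr (Or.inr (Or.inr ⟨_, _, _, _, _, rfl, h₃, hy, rfl⟩)))) h₄

/-! ### The stable affine model and its univariate substructure. -/

/-- The graded sets with finitely many indeterminates. -/
def full : CombStr .affine {f : GSet // ∃ n, Bdd n f} where
  app f g := ⟨f.1.app g.1, by
    obtain ⟨n, hn⟩ := f.2
    obtain ⟨k, hk⟩ := g.2
    exact ⟨max n k, (hn.mono (le_max_left _ _)).app (hk.mono (le_max_right _ _))⟩⟩
  comb c := ⟨pure (combTok c), 0, bdd_pure _ _⟩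

/-- The graded sets with a single indeterminate. -/
def univariate : CombStr .affine {f : GSet // Bdd 1 f} where
  app f g := ⟨f.1.app g.1, f.2.app g.2⟩
  comb c := ⟨pure (combTok c), bdd_pure _ _⟩

/-- A token in the grade given by a fresh indeterminate determines the arrows from it. -/
theorem app_fresh {n : ℕ} {f : GSet} (hf : Bdd n f) {a b : Token} {s : Multiset ℕ} :
    f.app (fun c t => c = a ∧ t = {n}) b (s + {n}) ↔ f (.arr a b) s := by
  constructor
  · rintro (h | ⟨_, s₁, _, h, ⟨rfl, rfl⟩, he⟩)
    · exact absurd (hf _ _ h n (by simp)) (lt_irrefl n)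
    · rwa [← add_right_cancel he]
  · exact fun h => app_arr h ⟨rfl, rfl⟩

/-- The empty argument reads off the constant arrows, as a fresh indeterminate does for the other
arrows. -/
theorem app_empty {f : GSet} {b : Token} {s : Multiset ℕ} :
    f.app (fun _ _ => False) b s ↔ f (.const b) s := by simp [app]

theorem full_isStableModel : full.IsStableModel ⟨pure ETok, 0, bdd_pure _ _⟩ where
  isCombAlgebra c := by
    cases c with
    | B => exact fun x y z => Subtype.ext (BTok_law _ _ _)
    | C => exact fun x y z => Subtype.ext (CTok_law _ _ _)
    | I => exact fun x => Subtype.ext (ITok_app _)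
    | K => exact fun x y => Subtype.ext (KTok_app_app _ _)
  app_app x y := Subtype.ext (ETok_app_app _ _)
  weakExt := by
    rintro ⟨x, k, hx⟩ ⟨y, l, hy⟩ h
    replace h (z : GSet) (hz : ∃ n, Bdd n z) : x.app z = y.app z :=
      congrArg Subtype.val (h ⟨z, hz⟩)
    refine Subtype.ext ?_
    funext t s
    refine propext (ETok_app.trans (Iff.trans ?_ ETok_app.symm))
    refine and_congr_right fun ht => ?_
    cases t with
    | atom => exact absurd rfl ht
    | const b =>
      change x _ s ↔ y _ s
      rw [← app_empty (f := x), ← app_empty (f := y), h _ ⟨0, fun _ _ hf => hf.elim⟩]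
    | arr a b =>
      change x _ s ↔ y _ s
      -- The indeterminate `max k l` is fresh for both `x` and `y`, so the test argument is the
      -- token `a` in grade `{max k l}`.
      rw [← app_fresh (hx.mono (le_max_left k l)), ← app_fresh (hy.mono (le_max_right k l)), h]
      refine ⟨max k l + 1, ?_⟩
      rintro _ _ ⟨_, rfl⟩ i hi
      rw [Multiset.mem_singleton.1 hi]
      exact Nat.lt_succ_self _
  fixed c := by
    cases c with
    | B =>
      refine ⟨Subtype.ext (ETok_app_eq_self ?_), fun x => Subtype.ext (ETok_app_eq_self ?_),
        fun x y => Subtype.ext (ETok_app_eq_self ?_)⟩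
      · rintro s ⟨⟨⟩, _⟩
      · intro s h
        simpa using BTok_app.1 h
      · intro s h
        simpa using BTok_app_app.1 h
    | C =>
      refine ⟨Subtype.ext (ETok_app_eq_self ?_), fun x => Subtype.ext (ETok_app_eq_self ?_),
        fun x y => Subtype.ext (ETok_app_eq_self ?_)⟩
      · rintro s ⟨⟨⟩, _⟩
      · intro s h
        simpa using CTok_app.1 h
      · intro s h
        simpa using CTok_app_app.1 h
    | I =>
      refine Subtype.ext (ETok_app_eq_self ?_)
      rintro s ⟨⟨⟩, _⟩
    | K =>
      refine ⟨Subtype.ext (ETok_app_eq_self ?_), fun x => Subtype.ext (ETok_app_eq_self ?_)⟩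
      · rintro s ⟨⟨⟩, _⟩
      · intro s h
        simpa using KTok_app.1 h

theorem univariate_isLambdaAlgebra : univariate.IsLambdaAlgebra :=
  full_isStableModel.isLambdaAlgebra_of_embedding
    (i := fun f : {f : GSet // Bdd 1 f} => ⟨f.1, 1, f.2⟩)
    (fun _ _ h => Subtype.ext (congrArg (fun z : {f : GSet // ∃ n, Bdd n f} => z.1) h))
    (fun _ _ => rfl) (fun _ => rfl)

theorem univariate_not_isCombinatoryModel : ¬ univariate.IsCombinatoryModel := by
  rintro ⟨-, ⟨ε, hε⟩, happ, hext⟩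
  replace happ {x y : GSet} (hx : Bdd 1 x) (hy : Bdd 1 y) : (ε.app x).app y = x.app y :=
    congrArg Subtype.val (happ ⟨x, hx⟩ ⟨y, hy⟩)
  -- Every grade of the token `const atom` hides the presence of the token `arr atom atom`.
  let x : GSet := fun t s => t = .const .atom ∧ ∀ i ∈ s, i < 1
  let x' : GSet := fun t s => x t s ∨ t = .arr .atom .atom ∧ s = 0
  have hx : Bdd 1 x := fun _ _ h => h.2
  have hx' : Bdd 1 x' := by
    rintro t s (h | ⟨_, rfl⟩) i hi
    · exact h.2 i hi
    · simp at hi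
  have hxx' : ε.app x = ε.app x' := by
    refine congrArg Subtype.val (hext ⟨x, hx⟩ ⟨x', hx'⟩ fun z => Subtype.ext ?_)
    funext t s
    refine propext ⟨?_, ?_⟩
    · rintro (h | ⟨a, s₁, s₂, h₁, h₂, rfl⟩)
      · exact app_const (Or.inl h)
      · exact app_arr (Or.inl h₁) h₂
    · rintro ((h | ⟨⟨⟩, _⟩) | ⟨a, s₁, s₂, ⟨⟨⟩, _⟩ | ⟨⟨⟩, rfl⟩, h₂, rfl⟩)
      · exact app_const h
      -- The extra arrow contributes an atom in some grade of `z`, and `x` already yields the atom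
      -- in every univariate grade.
      · exact app_const ⟨rfl, by simpa using z.2 _ _ h₂⟩
  have hempty : Bdd 1 fun _ _ => False := fun _ _ h => h.elim
  have hmem : ε.app x' (.arr .atom .atom) 0 := by
    -- It suffices to see what `ε` does to the singleton `arr atom atom`, which is contained in
    -- `x'`, since application is monotone.
    have h : (ε.app (pure (· = .arr .atom .atom))).app (pure (· = .atom)) .atom 0 := by
      rw [happ (bdd_pure _ _) (bdd_pure _ _)]
      exact app_arr (s₁ := 0) (s₂ := 0) ⟨rfl, rfl⟩ ⟨rfl, rfl⟩
    rcases h with h | ⟨_, s₁, _, h, ⟨rfl, rfl⟩, hs⟩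
    -- A constant arrow in the image of the singleton would survive the empty argument, but the
    -- singleton has none.
    · have := app_empty.2 h
      rw [happ (bdd_pure _ _) hempty, app_empty] at this
      exact absurd this.1 (by simp)
    · rw [add_zero] at hs
      subst hs
      rcases h with h | ⟨a, s₁, s₂, h₁, h₂, hs⟩
      · exact app_const h
      · exact hs ▸ app_arr h₁ (Or.inr h₂)
  rw [← hxx'] at hmem
  -- As `x` holds only the token `const atom`, `ε` makes the arrow either from no argument at all or
  -- from `const atom`. The first would let the empty set act nontrivially.
  rcases hmem with h | ⟨_, s₁, s₂, h₁, ⟨rfl, _⟩, hs⟩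
  · have := app_arr (g := pure (· = .atom)) (s₂ := 0) (app_empty.2 h) ⟨rfl, rfl⟩
    rw [happ hempty (bdd_pure _ _)] at this
    simp [app] at this
  · obtain ⟨rfl, rfl⟩ := add_eq_zero.1 hs
    -- An atom in grade `{0}` tells whether the argument is used: the arrow made by `ε` passes the
    -- grade on, whereas `const atom` yields the atom in grade `0` only.
    have hz : Bdd 1 fun t s => t = .atom ∧ s = {0} := by
      rintro _ _ ⟨_, rfl⟩ i hi
      simp [Multiset.mem_singleton.1 hi]
    have := app_arr (g := fun t s => t = .atom ∧ s = {0}) (s₂ := {0})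
      (app_arr (g := pure (· = .const .atom)) (s₂ := 0) h₁ ⟨rfl, rfl⟩) ⟨rfl, rfl⟩
    rw [happ (bdd_pure _ _) hz] at this
    rcases this with h | ⟨_, _, _, ⟨⟨⟩, _⟩, _⟩
    simp [pure] at h

end GSet

/-! ### Failure of extensionality for partial involutions. -/

namespace PInv

open Move Relation

/-- The nowhere defined partial involution. -/
def empty : PInv where
  rel _ _ := False
  functional _ _ _ h := h.elim
  symm _ _ h := h

/-- The partial involution that exchanges `a` and `b` and is undefined elsewhere. -/
def swap (a b : Move) : PInv where
  rel u v := u = a ∧ v = b ∨ u = b ∧ v = a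
  functional := by
    rintro u v w (⟨rfl, rfl⟩ | ⟨rfl, rfl⟩) (⟨h, rfl⟩ | ⟨h, rfl⟩) <;>
      first | rfl | exact h | exact h.symm
  symm _ _ h := by tauto

theorem app_empty_rel {f : PInv} {u v : Move} : (f.app empty).rel u v ↔ f.rel (r u) (r v) := by
  constructor
  · rintro (h | ⟨_, ⟨_, ⟨_, _, h⟩, _⟩, _⟩)
    · exact h
    · exact h.elim
  · exact Or.inl

theorem alg_not_isCombinatoryModel : ¬ alg.IsCombinatoryModel := by
  rintro ⟨-, ε, happ, hext⟩
  change ∀ x y : PInv, (ε.app x).app y = x.app y at happ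
  change ∀ x y : PInv, (∀ z : PInv, x.app z = y.app z) → ε.app x = ε.app y at hext
  -- The loop at `u` as argument sends a token from `v` back to `v`. The token must visit the
  -- argument, as otherwise it would also return with the empty argument; and the argument can be
  -- entered only at `u`.
  have hwire (u v : Move) : (ε.app (swap (l u) (r v))).rel (r v) (l u) := by
    have h : ((ε.app (swap (l u) (r v))).app (swap u u)).rel v v := by
      rw [happ]
      exact Or.inr ⟨u, ⟨u, ⟨u, Or.inr ⟨rfl, rfl⟩, Or.inl ⟨rfl, rfl⟩⟩, .refl⟩, Or.inl ⟨rfl, rfl⟩⟩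
    rcases h with h | ⟨_, ⟨_, ⟨a, ha, hab⟩, _⟩, _⟩
    · have h' := app_empty_rel.2 h
      rw [happ, app_empty_rel] at h'
      simp [swap] at h'
    · have : a = u := by simp [swap] at hab; exact hab.1
      rwa [this] at ha
  have hstep (u : Move) : ε.rel (r (r e)) (r (l u)) ∨
      ∃ a, ε.rel (r (r e)) (l a) ∧ (a = l u ∨ a = r e) := by
    rcases hwire u e with h | ⟨_, ⟨_, ⟨a, ha, hab⟩, _⟩, _⟩
    · exact Or.inl h
    · exact Or.inr ⟨a, ha, hab.imp And.left And.left⟩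
  -- The partner of `r (r e)` under `ε` does not depend on `u`. Comparing `u = e` with `u = l e`
  -- excludes the options that mention `u`.
  have hout : ε.rel (r (r e)) (l (r e)) := by
    rcases hstep e with h | ⟨a, ha, rfl | rfl⟩
    · rcases hstep (l e) with h' | ⟨a, ha, _⟩
      · simpa using ε.functional _ _ _ h h'
      · simpa using ε.functional _ _ _ h ha
    · rcases hstep (l e) with h' | ⟨a, ha', rfl | rfl⟩
      · simpa using ε.functional _ _ _ ha h'
      · simpa using ε.functional _ _ _ ha ha'
      · exact ha'
    · exact ha
  have hout' := ε.symm _ _ hout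
  -- By `hout` the token reaches `l e` in the argument. A detour back into the argument from there
  -- would return to `l (r e)`, whose partner is already `r (r e)`.
  have hinp : ε.rel (l (l e)) (r (l e)) := by
    rcases hwire e e with h | ⟨c, ⟨b, ⟨a, ha, hab⟩, hbc⟩, hc⟩
    · simpa using ε.functional _ _ _ hout h
    obtain rfl : r e = a := by simpa using ε.functional _ _ _ hout ha
    obtain rfl : b = l e := by simpa [swap] using hab
    rcases hbc.cases_head with rfl | ⟨b, ⟨d, hd, hdb⟩, hbc⟩
    · exact hc
    rcases hdb with ⟨rfl, rfl⟩ | ⟨rfl, rfl⟩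
    · rcases hbc.cases_head with rfl | ⟨_, ⟨d, hd, _⟩, _⟩
      · simpa using ε.functional _ _ _ hout' hc
      · simpa using ε.functional _ _ _ hout' hd
    · simpa using ε.functional _ _ _ hout' (ε.symm _ _ hd)
  have hinp' := ε.symm _ _ hinp
  -- The loop lies entirely under `l`, so no token from outside reaches it: the involution acts like
  -- the empty one on every argument.
  have heq : ε.app (swap (l e) (l e)) = ε.app empty := by
    refine hext _ _ fun z => PInv.ext ?_
    funext u v
    refine propext ⟨?_, ?_⟩
    · rintro (h | ⟨_, ⟨_, ⟨_, h, _⟩, _⟩, _⟩) <;> simp [sub, swap] at h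
    · rintro (h | ⟨_, ⟨_, ⟨_, h, _⟩, _⟩, _⟩) <;> exact h.elim
  -- By `hinp`, `ε` carries a token at `l e` into the loop and out again; with the empty argument it
  -- would need an edge from `r (l e)` to itself.
  have h : (ε.app (swap (l e) (l e))).rel (l e) (l e) :=
    Or.inr ⟨l e, ⟨l e, ⟨l e, hinp', Or.inl ⟨rfl, rfl⟩⟩, .refl⟩, hinp⟩
  rw [heq, app_empty_rel] at h
  simpa using ε.functional _ _ _ hinp' h

end PInv

end StrictLambda

theorem mainTheorem11 :
    (StrictLambda.PInv.alg.IsLambdaAlgebra ∧ ¬ StrictLambda.PInv.alg.IsCombinatoryModel) ∧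
      ∃ (A : Type) (S : StrictLambda.CombStr StrictLambda.Mode.affine A),
        S.IsLambdaAlgebra ∧ ¬ S.IsCombinatoryModel :=
  ⟨⟨StrictLambda.PInv.alg_isLambdaAlgebra, StrictLambda.PInv.alg_not_isCombinatoryModel⟩,
    _, StrictLambda.GSet.univariate, StrictLambda.GSet.univariate_isLambdaAlgebra,
    StrictLambda.GSet.univariate_not_isCombinatoryModel⟩
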